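/- Let $K=\mathbb{Q}(\sqrt D)$ be an imaginary-quadratic field, with $D<0$ a square-free integer; let $\mathfrak o$ be its ring of integers, $d_K$ its discriminant, $\alpha\mapsto\overline{\alpha}$ its non-trivial automorphism and $\mathcal C_K$ its ideal class group. A hermitian space over $K$ is a finite-dimensional $K$-vector space $V$ with a form $h:V\times V\to K$ that is linear in the first variable, semilinear in the second, and satisfies $h(x,y)=\overline{h(y,x)}$. A lattice on $V$ is a finitely generated $\mathfrak o$-submodule $L\subseteq V$ with $K\cdot L=V$; its rank is $\dim_K V$, and it is definite if $h(x,x)>0$ for all $x\in V\setminus\{0\}$. Write $L=\mathfrak a_1x_1+\dots+\mathfrak a_nx_n$ with a basis $x_1,\dots,x_n$ of $V$ and fractional ideals $\mathfrak a_i\neq 0$ of $K$. The Steinitz class of $L$ is the class of $\prod_i\mathfrak a_i$ in $\mathcal C_K$, and the volume of $L$ is the fractional ideal $\prod_i\mathfrak a_i\overline{\mathfrak a_i}\cdot\det(h(x_i,x_j))_{i,j}$; neither depends on the chosen decomposition. The lattice $L$ is unimodular if its volume is $\mathfrak o$ and the $\mathfrak o$-module generated by all $h(x,y)$, $x,y\in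 L$, is $\mathfrak o$. It is even if $h(x,x)\in 2\mathfrak o$ for all $x\in L$, and odd otherwise. For a prime $p$ and $\alpha\in\mathbb{Q}_p^*$, let $(\alpha,K/\mathbb{Q})_p$ be $+1$ if $\alpha$ is the norm of a unit of $K_p=K\otimes_{\mathbb Q}\mathbb{Q}_p$, and $-1$ otherwise. Let $\mathfrak a$ be a nonzero fractional ideal of $K$, with class $[\mathfrak a]\in\mathcal C_K$ and norm $N(\mathfrak a)$, and let $n\ge 1$ be an integer. a) There is a definite odd unimodular lattice of rank $n$ over $K$ with Steinitz class $[\mathfrak a]$. b) There is a definite even unimodular lattice of rank $n$ over $K$ with Steinitz class $[\mathfrak a]$ if and only if the following three conditions hold: (i) $d_K$ is even; (ii) $n$ is even; (iii) if $D\equiv 3 \pmod 4$, then $(N(\mathfrak a),K/\mathbb{Q})_2=(-1)^{n/2}$. -/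

import Mathlib

open NumberField Module
open scoped nonZeroDivisors TensorProduct

universe u

/-- A hermitian space over `K`: a finite-dimensional `K`-vector space with a form that is linear in
the first and `σ`-semilinear in the second variable and satisfies `h(x,y) = σ(h(y,x))`; here `σ` is
the conjugation of `K`. The `𝓞 K`-module structure is the restriction of the `K`-module structure,
as the scalar tower condition says. -/
structure HermitianSpace (K : Type u) [Field K] [NumberField K] (σ : K ≃ₐ[ℚ] K) where
  carrier : Type u
  [addCommGroup : AddCommGroup carrier]
  [module : Module K carrier]
  [finite : Module.Finite K carrier]
  [moduleInt : Module (𝓞 K) carrier]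
  [tower : IsScalarTower (𝓞 K) K carrier]
  form : carrier →ₗ[K] carrier →ₛₗ[(σ : K →+* K)] K
  form_conj : ∀ x y, form x y = σ (form y x)

attribute [instance] HermitianSpace.addCommGroup HermitianSpace.module HermitianSpace.finite
  HermitianSpace.moduleInt HermitianSpace.tower

/-- A hermitian lattice in `V`: a finitely generated `𝓞 K`-submodule of `V`. -/
structure HermitianLattice {K : Type u} [Field K] [NumberField K] {σ : K ≃ₐ[ℚ] K}
    (V : HermitianSpace K σ) where
  toSubmodule : Submodule (𝓞 K) V.carrier
  fg : toSubmodule.FG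

namespace HermitianLattice

variable {K : Type u} [Field K] [NumberField K] {σ : K ≃ₐ[ℚ] K} {V : HermitianSpace K σ}

/-- The subspace `K·L` of `V`. -/
def spanField (L : HermitianLattice V) : Submodule K V.carrier :=
  Submodule.span K (L.toSubmodule : Set V.carrier)

/-- The rank of `L`, i.e. the dimension of `K·L`. -/
noncomputable def rank (L : HermitianLattice V) : ℕ := finrank K L.spanField

/-- `L` is a lattice on `V`, i.e. `K·L = V`. -/
def IsOn (L : HermitianLattice V) : Prop := L.spanField = ⊤

/-- `L` is (positive) definite: `h(x,x)` is a positive rational number for all nonzero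
`x ∈ K·L`. -/
def IsDefinite (L : HermitianLattice V) : Prop :=
  ∀ x ∈ L.spanField, x ≠ 0 → ∃ q : ℚ, 0 < q ∧ V.form x x = algebraMap ℚ K q

/-- The scale of `L`: the `𝓞 K`-submodule of `K` generated by all `h(x,y)` with `x, y ∈ L`. -/
def scale (L : HermitianLattice V) : Submodule (𝓞 K) K :=
  Submodule.span (𝓞 K) {a | ∃ x ∈ L.toSubmodule, ∃ y ∈ L.toSubmodule, V.form x y = a}

/-- The norm of `L`: the `𝓞 K`-submodule of `K` generated by all `h(x,x)` with `x ∈ L`. -/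
def normIdeal (L : HermitianLattice V) : Submodule (𝓞 K) K :=
  Submodule.span (𝓞 K) {a | ∃ x ∈ L.toSubmodule, V.form x x = a}

/-- `L` is even if its norm is contained in `2·𝓞 K`. -/
def IsEven (L : HermitianLattice V) : Prop :=
  L.normIdeal ≤ Submodule.span (𝓞 K) {(2 : K)}

/-- `L` is odd if it is not even. -/
def IsOdd (L : HermitianLattice V) : Prop := ¬ L.IsEven

/-- A decomposition `L = 𝔞₁x₁ + ⋯ + 𝔞ₙxₙ` with a basis `x₁, …, xₙ` of `V` and nonzero fractional
ideals `𝔞₁, …, 𝔞ₙ` of `K`: the elements of `L` are the vectors whose `i`-th coordinate lies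
in `𝔞ᵢ`, for every `i`. Every lattice on `V` has such a decomposition. -/
structure PseudoBasis (L : HermitianLattice V) (n : ℕ) where
  basis : Basis (Fin n) K V.carrier
  ideal : Fin n → (FractionalIdeal (𝓞 K)⁰ K)ˣ
  mem_iff : ∀ v : V.carrier, v ∈ L.toSubmodule ↔
    ∀ i, basis.repr v i ∈ (ideal i : FractionalIdeal (𝓞 K)⁰ K)

/-- The product `∏ 𝔞ᵢ · σ(𝔞ᵢ) · det(h(xᵢ,xⱼ))`, as an `𝓞 K`-submodule of `K`. -/
noncomputable def PseudoBasis.volume {L : HermitianLattice V} {n : ℕ} (P : L.PseudoBasis n) :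
    Submodule (𝓞 K) K :=
  (∏ i, ((P.ideal i : FractionalIdeal (𝓞 K)⁰ K) : Submodule (𝓞 K) K) *
      Submodule.span (𝓞 K) (σ '' {a : K | a ∈ (P.ideal i : FractionalIdeal (𝓞 K)⁰ K)})) *
    Submodule.span (𝓞 K) {(Matrix.of fun i j => V.form (P.basis i) (P.basis j)).det}

/-- `L` has volume `𝔳`; the volume does not depend on the decomposition. -/
def HasVolume (L : HermitianLattice V) (𝔳 : Submodule (𝓞 K) K) : Prop :=
  ∃ (n : ℕ) (P : L.PseudoBasis n), P.volume = 𝔳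

/-- The Steinitz class of `L` is `c`, i.e. `c` is the class of `∏ 𝔞ᵢ` for a decomposition
`L = 𝔞₁x₁ + ⋯ + 𝔞ₙxₙ`; the class does not depend on the decomposition. -/
def HasSteinitzClass (L : HermitianLattice V) (c : ClassGroup (𝓞 K)) : Prop :=
  ∃ (n : ℕ) (P : L.PseudoBasis n), ClassGroup.mk K (∏ i, P.ideal i) = c

/-- `L` is a unimodular lattice on `V`: its scale and its volume are both `𝓞 K`. -/
def IsUnimodular (L : HermitianLattice V) : Prop :=
  L.IsOn ∧ L.scale = 1 ∧ L.HasVolume 1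

end HermitianLattice

open Classical in
/-- The local norm residue symbol `(α, K/ℚ)_p` of a nonzero `α ∈ ℚ_p`: it is `1` if `α` is the norm
of a unit of `K_p = ℚ_p ⊗ K`, and `-1` otherwise. -/
noncomputable def normResidueSymbol (K : Type u) [Field K] [NumberField K] (p : ℕ)
    [Fact p.Prime] (α : ℚ_[p]) : ℤ :=
  if ∃ x : (ℚ_[p] ⊗[ℚ] K)ˣ, Algebra.norm ℚ_[p] (x : ℚ_[p] ⊗[ℚ] K) = α then 1 else -1

/-! Write N for the ideal norm. The identity 𝔞σ(𝔞) = N(𝔞)𝓞 makes 𝔞 with the form N(𝔞)⁻¹xσ(y) a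
definite unimodular lattice of rank one. Adding copies of ⟨1⟩ gives every rank and Steinitz class.
Since N(𝔞) is an integral combination of norms of elements of 𝔞, some t ∈ 𝔞 has norm m·N(𝔞) with m
odd (`exists_odd_norm`), so this lattice M is odd, which is a).

For necessity in b), polarising an even form shows that the traces of all elements of the scale are
even. As the scale is 𝓞, this excludes D ≡ 1 (mod 4), so that 𝓞 = ℤ[√D]. In a decomposition with
ideals 𝔞ᵢ and vectors xᵢ, choose aᵢ ∈ 𝔞ᵢ whose norm is mᵢN(𝔞ᵢ) with mᵢ odd. The Gram matrix of the
aᵢxᵢ is hermitian over ℤ[√D] with even diagonal. By definiteness ∏N(𝔞ᵢ)·det(h(xᵢ,xⱼ)) is the number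
1, not merely a unit, so the Gram determinant is ∏mᵢ. Modulo the prime above 2 the diagonal vanishes
while the determinant does not, so binary blocks of odd determinant can be split off
(`IsEvenHermitian.even_and_det_modEq`). Hence n is even. If D ≡ 3 (mod 4), each block has
determinant ≡ -1 (mod 4), because odd norms are ≡ 1. Up to a global norm N(𝔞) equals ∏mᵢ, and on odd
integers the symbol at 2 is the residue modulo 4 (`normResidueSymbol_two`).

For sufficiency, let P be the prime with P² = 2𝓞 and w = (1,…,1,t) in M, so that h(w,w) = n - 1 + m.
If 4 divides this number, the neighbour of M at P built on w is even and unimodular with the same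
Steinitz class (`exists_even_unimodular_of_mem`). For D ≡ 3 (mod 4) condition (iii) is exactly this
divisibility. For D ≡ 2 (mod 4) it can be forced by replacing t with (1+√D)t, since 1 + √D has norm
1 - D ≡ -1 (mod 4). -/

/-- `K = ℚ(δ)` with `δ² = D` a negative square-free integer, and `σ` is its conjugation. -/
structure IsImaginaryQuadratic {K : Type u} [Field K] [NumberField K] (D : ℤ) (δ : K)
    (σ : K ≃ₐ[ℚ] K) : Prop where
  neg : D < 0
  squarefree : Squarefree D
  sq : δ ^ 2 = (D : K)
  exists_repr : ∀ x : K, ∃ a b : ℚ, x = a + b * δ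
  conj : σ δ = -δ

/-! ### The quadratic field: norm, trace, integers and parity of the discriminant. -/

/-- The norm of `x + yδ` in a quadratic algebra with basis `1, δ`. -/
theorem Algebra.norm_eq_of_basis_one_sqrt {R A : Type*} [CommRing R] [CommRing A] [Algebra R A]
    (b : Basis (Fin 2) R A) (h0 : b 0 = 1) {d : R} (h1 : b 1 ^ 2 = algebraMap R A d) (x y : R) :
    Algebra.norm R (x • b 0 + y • b 1) = x ^ 2 - d * y ^ 2 := by
  have e0 : (x • b 0 + y • b 1) * b 0 = x • b 0 + y • b 1 := by rw [h0, mul_one]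
  have e1 : (x • b 0 + y • b 1) * b 1 = (d * y) • b 0 + x • b 1 := by
    rw [add_mul, smul_mul_assoc, smul_mul_assoc, ← sq, h1, h0, one_mul, add_comm,
      Algebra.algebraMap_eq_smul_one, smul_smul, mul_comm y d]
  rw [Algebra.norm_eq_matrix_det b, Matrix.det_fin_two]
  simp only [Algebra.leftMulMatrix_eq_repr_mul, e0, e1]
  simp
  ring

namespace IsImaginaryQuadratic

variable {K : Type u} [Field K] [NumberField K] {D : ℤ} {δ : K} {σ : K ≃ₐ[ℚ] K}

theorem ne_ratCast_of_sq_eq {D : ℤ} (hD : D < 0) {δ : K} (hδ : δ ^ 2 = (D : K)) (q : ℚ) :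
    δ ≠ (q : K) := by
  rintro rfl
  have h : q ^ 2 = (D : ℚ) := by exact_mod_cast hδ
  have : (D : ℚ) < 0 := by exact_mod_cast hD
  nlinarith [sq_nonneg q]

/-- The sums a + bδ are closed under multiplication because δ² is rational, so they exhaust K. An
automorphism sends δ to a root of X² - D, and one that fixes δ is trivial. -/
theorem of_adjoin (hD : D < 0) (hsq : Squarefree D) (hδ : δ ^ 2 = (D : K))
    (hK : IntermediateField.adjoin ℚ {δ} = ⊤) (hσ : σ ≠ AlgEquiv.refl) :
    IsImaginaryQuadratic D δ σ := by
  have hrep : ∀ x : K, ∃ a b : ℚ, x = a + b * δ := by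
    intro x
    have hx : x ∈ Algebra.adjoin ℚ {δ} := by
      rw [← IntermediateField.adjoin_simple_toSubalgebra_of_isAlgebraic
        (Algebra.IsAlgebraic.isAlgebraic δ), hK]
      trivial
    induction hx using Algebra.adjoin_induction with
    | mem x hx => exact ⟨0, 1, by simp [Set.mem_singleton_iff.1 hx]⟩
    | algebraMap r => exact ⟨r, 0, by simp⟩
    | add x y _ _ hx hy =>
      obtain ⟨a, b, rfl⟩ := hx
      obtain ⟨c, d, rfl⟩ := hy
      exact ⟨a + c, b + d, by push_cast; ring⟩
    | mul x y _ _ hx hy =>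
      obtain ⟨a, b, rfl⟩ := hx
      obtain ⟨c, d, rfl⟩ := hy
      refine ⟨a * c + D * b * d, a * d + b * c, ?_⟩
      push_cast
      linear_combination b * d * hδ
  refine ⟨hD, hsq, hδ, hrep, ?_⟩
  have h1 : σ δ ^ 2 = δ ^ 2 := by rw [← map_pow, hδ, map_intCast]
  refine (sq_eq_sq_iff_eq_or_eq_neg.1 h1).resolve_left fun h => hσ ?_
  ext x
  obtain ⟨a, b, rfl⟩ := hrep x
  simp [h]

theorem ne_ratCast (h : IsImaginaryQuadratic D δ σ) (q : ℚ) : δ ≠ (q : K) :=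
  ne_ratCast_of_sq_eq h.neg h.sq q

theorem linearIndependent (h : IsImaginaryQuadratic D δ σ) :
    LinearIndependent ℚ ![(1 : K), δ] := by
  rw [LinearIndependent.pair_iff]
  intro s t hst
  simp only [Algebra.smul_def, eq_ratCast, mul_one] at hst
  have ht : t = 0 := by
    by_contra ht
    have ht' : (t : K) ≠ 0 := by exact_mod_cast ht
    refine h.ne_ratCast (-s / t) ?_
    push_cast
    field_simp
    linear_combination hst
  subst ht
  simpa using hst

/-- The basis `1, δ` of `K` over `ℚ`. -/
noncomputable def basis (h : IsImaginaryQuadratic D δ σ) : Basis (Fin 2) ℚ K :=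
  Basis.mk h.linearIndependent fun x _ => by
    obtain ⟨a, b, rfl⟩ := h.exists_repr x
    refine Submodule.mem_span_range_iff_exists_fun ℚ |>.2 ⟨![a, b], ?_⟩
    simp [Fin.sum_univ_two, Algebra.smul_def]

@[simp] theorem basis_zero (h : IsImaginaryQuadratic D δ σ) : h.basis 0 = 1 := by
  simp [basis]

@[simp] theorem basis_one (h : IsImaginaryQuadratic D δ σ) : h.basis 1 = δ := by
  simp [basis]

theorem finrank_eq_two (h : IsImaginaryQuadratic D δ σ) : finrank ℚ K = 2 := by
  simpa using finrank_eq_card_basis h.basis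

theorem norm_eq (h : IsImaginaryQuadratic D δ σ) (a b : ℚ) :
    Algebra.norm ℚ ((a : K) + b * δ) = a ^ 2 - D * b ^ 2 := by
  have := Algebra.norm_eq_of_basis_one_sqrt h.basis h.basis_zero (d := (D : ℚ))
    (by simpa using h.sq) a b
  simpa [Algebra.smul_def] using this

theorem conj_add_mul (h : IsImaginaryQuadratic D δ σ) (a b : ℚ) :
    σ ((a : K) + b * δ) = a - b * δ := by
  simp [h.conj, sub_eq_add_neg]

@[simp] theorem conj_conj (h : IsImaginaryQuadratic D δ σ) (x : K) : σ (σ x) = x := by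
  obtain ⟨a, b, rfl⟩ := h.exists_repr x
  simp [h.conj]

theorem mul_conj (h : IsImaginaryQuadratic D δ σ) (x : K) :
    x * σ x = (Algebra.norm ℚ x : ℚ) := by
  obtain ⟨a, b, rfl⟩ := h.exists_repr x
  rw [h.norm_eq, h.conj_add_mul]
  push_cast
  linear_combination - b ^ 2 * h.sq

theorem norm_pos (h : IsImaginaryQuadratic D δ σ) {x : K} (hx : x ≠ 0) :
    0 < Algebra.norm ℚ x := by
  refine lt_of_le_of_ne ?_ (Ne.symm (Algebra.norm_ne_zero_iff.2 hx))
  obtain ⟨a, b, rfl⟩ := h.exists_repr x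
  rw [h.norm_eq]
  have : (D : ℚ) < 0 := by exact_mod_cast h.neg
  nlinarith [sq_nonneg a, sq_nonneg b]

theorem exists_ratCast_of_conj_eq (h : IsImaginaryQuadratic D δ σ) {x : K} (hx : σ x = x) :
    ∃ q : ℚ, x = q := by
  obtain ⟨a, b, rfl⟩ := h.exists_repr x
  rw [h.conj_add_mul] at hx
  refine ⟨a, ?_⟩
  have : (b : K) * δ = 0 := by linear_combination (-1 / 2 : K) * hx
  rw [this, add_zero]

/-- A rational number that is integral over `ℤ` in `K` is an integer. -/
theorem exists_intCast_of_isIntegral {q : ℚ} (hq : IsIntegral ℤ (q : K)) : ∃ m : ℤ, q = m := by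
  have : IsIntegral ℤ q := by
    rw [← eq_ratCast (algebraMap ℚ K)] at hq
    exact (isIntegral_algebraMap_iff (algebraMap ℚ K).injective).1 hq
  obtain ⟨m, hm⟩ := IsIntegrallyClosed.isIntegral_iff.1 this
  exact ⟨m, by simpa using hm.symm⟩

/-- With b in lowest terms, the square of its denominator is prime to the square of its numerator
and hence divides D. -/
theorem _root_.Squarefree.exists_intCast_of_mul_sq {D : ℤ} (hD : Squarefree D) {b : ℚ} {m : ℤ}
    (h : (D : ℚ) * b ^ 2 = m) : ∃ c : ℤ, b = c := by
  have hb : (b.den : ℚ) ≠ 0 := by exact_mod_cast b.den_nz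
  have h2 : D * b.num ^ 2 = m * (b.den : ℤ) ^ 2 := by
    have h3 : (D : ℚ) * (b.num : ℚ) ^ 2 = m * (b.den : ℚ) ^ 2 := by
      rw [← h]
      nth_rewrite 2 [← Rat.num_div_den b]
      field_simp
    exact_mod_cast h3
  have hcop : IsCoprime ((b.den : ℤ) ^ 2) (b.num ^ 2) := by
    refine IsCoprime.pow ?_
    rw [Int.isCoprime_iff_gcd_eq_one, Int.gcd_comm]
    exact b.reduced
  have hdvd : (b.den : ℤ) * b.den ∣ D := by
    rw [← pow_two]
    exact hcop.dvd_of_dvd_mul_right (Dvd.intro_left _ h2.symm)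
  have := hD _ hdvd
  have h1 : b.den = 1 := by
    rw [Int.isUnit_iff_natAbs_eq] at this
    simpa using this
  exact ⟨b.num, (Rat.coe_int_num_of_den_eq_one h1).symm⟩

/-- The integers of `ℚ(√D)` for `D ≢ 1 (mod 4)`. -/
theorem exists_int_repr (h : IsImaginaryQuadratic D δ σ) (hD : ¬ D ≡ 1 [ZMOD 4]) {x : K}
    (hx : IsIntegral ℤ x) : ∃ a b : ℤ, x = a + b * δ := by
  obtain ⟨a, b, rfl⟩ := h.exists_repr x
  have hσ : IsIntegral ℤ (σ ((a : K) + b * δ)) := hx.map (σ.restrictScalars ℤ)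
  -- Trace and norm are integers A and N. Then D(2b)² = A² - 4N forces 2b = B to be an integer as D
  -- is square-free, and A² ≡ DB² (mod 4) with D ≡ 2 or 3 leaves only A and B even.
  obtain ⟨A, hA⟩ : ∃ A : ℤ, 2 * a = A := by
    refine exists_intCast_of_isIntegral (K := K) ?_
    have e : ((2 * a : ℚ) : K) = a + b * δ + σ (a + b * δ) := by
      rw [h.conj_add_mul]; push_cast; ring
    rw [e]
    exact hx.add hσ
  obtain ⟨N, hN⟩ : ∃ N : ℤ, a ^ 2 - D * b ^ 2 = N := by
    refine exists_intCast_of_isIntegral (K := K) ?_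
    rw [← h.norm_eq, ← h.mul_conj]
    exact hx.mul hσ
  obtain ⟨B, hB⟩ : ∃ B : ℤ, 2 * b = B :=
    h.squarefree.exists_intCast_of_mul_sq (m := A ^ 2 - 4 * N) (by
      push_cast; rw [← hA, ← hN]; ring)
  have key : A ^ 2 - D * B ^ 2 = 4 * N := by
    have : (A : ℚ) ^ 2 - D * (B : ℚ) ^ 2 = 4 * N := by rw [← hA, ← hN, ← hB]; ring
    exact_mod_cast this
  have h4 : ¬ D ≡ 0 [ZMOD 4] := by
    intro h0
    have : (2 : ℤ) * 2 ∣ D := by simpa using Int.modEq_zero_iff_dvd.1 h0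
    have := h.squarefree 2 this
    rw [Int.isUnit_iff] at this
    omega
  have hAB : Even A ∧ Even B := by
    have hmod : (A ^ 2 - D * B ^ 2) % 4 = 0 := by rw [key]; omega
    have hDm : D % 4 = 2 ∨ D % 4 = 3 := by
      simp only [Int.ModEq] at hD h4
      omega
    rcases Int.even_or_odd' A with ⟨k, rfl | rfl⟩ <;> rcases Int.even_or_odd' B with ⟨l, rfl | rfl⟩
    · simp
    · exfalso
      have e : (2 * k) ^ 2 - D * (2 * l + 1) ^ 2 = 4 * (k ^ 2 - D * (l ^ 2 + l)) - D := by ring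
      omega
    · exfalso
      have e : (2 * k + 1) ^ 2 - D * (2 * l) ^ 2 = 4 * (k ^ 2 + k - D * l ^ 2) + 1 := by ring
      omega
    · exfalso
      have e : (2 * k + 1) ^ 2 - D * (2 * l + 1) ^ 2
          = 4 * (k ^ 2 + k - D * (l ^ 2 + l)) + 1 - D := by ring
      omega
  obtain ⟨⟨a', ha'⟩, ⟨b', hb'⟩⟩ := hAB
  refine ⟨a', b', ?_⟩
  have ea : a = a' := by
    have : (2 : ℚ) * a = a' + a' := by rw [hA, ha']; push_cast; ring
    linarith
  have eb : b = b' := by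
    have : (2 : ℚ) * b = b' + b' := by rw [hB, hb']; push_cast; ring
    linarith
  rw [ea, eb]
  simp

theorem isIntegral_sqrt (h : IsImaginaryQuadratic D δ σ) : IsIntegral ℤ δ := by
  refine IsIntegral.of_pow (n := 2) (by norm_num) ?_
  rw [h.sq]
  exact isIntegral_algebraMap (R := ℤ) (x := D)

theorem isIntegral_one_add_div_two (h : IsImaginaryQuadratic D δ σ) (hD : D ≡ 1 [ZMOD 4]) :
    IsIntegral ℤ ((1 + δ) / 2) := by
  obtain ⟨k, hk⟩ := (Int.modEq_iff_dvd.1 hD.symm)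
  have hk' : (D : K) = 1 + 4 * k := by
    have : D = 1 + 4 * k := by linarith
    rw [this]; push_cast; ring
  refine ⟨Polynomial.X ^ 2 - Polynomial.X - Polynomial.C k, ?_, ?_⟩
  · monicity!
  · simp only [Polynomial.eval₂_sub, Polynomial.eval₂_pow, Polynomial.eval₂_X,
      Polynomial.eval₂_C]
    rw [eq_intCast]
    linear_combination (h.sq + hk') / 4

/-- For `D ≢ 1 (mod 4)` the traces of integers are even. -/
theorem add_conj_mem (h : IsImaginaryQuadratic D δ σ) (hD : ¬ D ≡ 1 [ZMOD 4]) {x : K}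
    (hx : IsIntegral ℤ x) : ∃ a : ℤ, x + σ x = 2 * a := by
  obtain ⟨a, b, rfl⟩ := h.exists_int_repr hD hx
  refine ⟨a, ?_⟩
  simp [h.conj]
  ring

theorem add_conj_eq_trace (h : IsImaginaryQuadratic D δ σ) (x : K) :
    x + σ x = (Algebra.trace ℚ K x : ℚ) := by
  have h0 : Algebra.trace ℚ K δ = 0 := by
    rw [Algebra.trace_eq_matrix_trace h.basis, Matrix.trace_fin_two]
    simp only [Algebra.leftMulMatrix_eq_repr_mul]
    have e0 : δ * h.basis 0 = h.basis 1 := by simp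
    have e1 : δ * h.basis 1 = (D : ℚ) • h.basis 0 := by
      rw [h.basis_one, h.basis_zero, ← pow_two, h.sq]
      simp [Algebra.smul_def]
    rw [e0, e1, map_smul]
    simp only [Basis.repr_self, Finsupp.smul_apply]
    simp
  obtain ⟨a, b, rfl⟩ := h.exists_repr x
  rw [h.conj_add_mul]
  have e : (a : K) + b * δ = algebraMap ℚ K a + b • δ := by simp [Algebra.smul_def]
  rw [e, map_add, map_smul, h0, Algebra.trace_algebraMap, h.finrank_eq_two]
  simp [Algebra.smul_def]
  ring

/-- For D ≡ 1 (mod 4) the pair 1, (1+δ)/2 has odd discriminant D, which is a square times the field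
discriminant. Otherwise every trace is even, so the trace matrix is twice an integral one. -/
theorem even_discr_iff (h : IsImaginaryQuadratic D δ σ) :
    Even (NumberField.discr K) ↔ ¬ D ≡ 1 [ZMOD 4] := by
  classical
  have hcard : Fintype.card (Module.Free.ChooseBasisIndex ℤ (𝓞 K)) = 2 := by
    rw [← finrank_eq_card_chooseBasisIndex, RingOfIntegers.rank, h.finrank_eq_two]
  constructor
  · intro hev hD
    let e : Fin 2 ≃ Module.Free.ChooseBasisIndex ℤ (𝓞 K) := (Fintype.equivFinOfCardEq hcard).symm
    let B := (RingOfIntegers.basis K).reindex e.symm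
    let ω : 𝓞 K := ⟨(1 + δ) / 2, h.isIntegral_one_add_div_two hD⟩
    have hω : (ω : K) = (1 + δ) / 2 := rfl
    have h1 := Algebra.discr_of_matrix_vecMul B (B.toMatrix ![1, ω])
    have h2 : Matrix.vecMul (B : Fin 2 → 𝓞 K)
        ((B.toMatrix ![1, ω]).map (algebraMap ℤ (𝓞 K))) = ![1, ω] := by
      ext1 i
      simp only [Matrix.vecMul, dotProduct, Matrix.map_apply]
      conv_rhs => rw [← B.sum_toMatrix_smul_self ![1, ω] i]
      refine Finset.sum_congr rfl fun j _ => ?_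
      rw [Algebra.smul_def, mul_comm]
    have h3 : Algebra.discr ℤ (B : Fin 2 → 𝓞 K) = NumberField.discr K :=
      (NumberField.discr_eq_discr K B)
    rw [h2, h3] at h1
    have h4 : Algebra.discr ℤ ![1, ω] = D := by
      have : ((Algebra.discr ℤ ![1, ω] : ℤ) : K) = D := by
        rw [Algebra.discr_def, Matrix.det_fin_two]
        have tr : ∀ x : 𝓞 K, ((Algebra.trace ℤ (𝓞 K) x : ℤ) : K) = x + σ x := by
          intro x
          rw [h.add_conj_eq_trace, ← Algebra.coe_trace_int]
          simp
        simp only [Algebra.traceMatrix_apply, Algebra.traceForm_apply]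
        push_cast
        simp only [tr, map_mul]
        have h2 : σ (2 : K) = 2 := map_ofNat σ 2
        simp [hω, h.conj, h2]
        linear_combination h.sq
      exact_mod_cast this
    rw [h4] at h1
    obtain ⟨k, hk⟩ := hev
    rw [hk] at h1
    have : (B.toMatrix ![1, ω]).det ^ 2 * (k + k) = 2 * ((B.toMatrix ![1, ω]).det ^ 2 * k) := by
      ring
    simp only [Int.ModEq] at hD
    omega
  · intro hD
    have hM : ∀ i j, ∃ a : ℤ, Algebra.traceMatrix ℤ (RingOfIntegers.basis K) i j = 2 * a := by
      intro i j
      obtain ⟨a, ha⟩ := h.add_conj_mem hD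
        (RingOfIntegers.isIntegral_coe (RingOfIntegers.basis K i * RingOfIntegers.basis K j))
      refine ⟨a, ?_⟩
      rw [h.add_conj_eq_trace, ← Algebra.coe_trace_int] at ha
      rw [Algebra.traceMatrix_apply, Algebra.traceForm_apply]
      exact_mod_cast ha
    choose M hM using hM
    have : Algebra.traceMatrix ℤ (RingOfIntegers.basis K) = (2 : ℤ) • Matrix.of M := by
      ext i j
      rw [hM]
      simp
    rw [NumberField.discr, Algebra.discr_def, this, Matrix.det_smul, hcard]
    exact (Even.pow_of_ne_zero even_two two_ne_zero).mul_right _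

end IsImaginaryQuadratic

/-! ### Norms of fractional ideals and of their elements. -/

open scoped Pointwise in
/-- Every element of a fractional ideal is a quotient of an element of its numerator by its
denominator, and conversely. -/
theorem FractionalIdeal.mem_iff_num_div_den {K : Type*} [Field K]
    (I : FractionalIdeal (𝓞 K)⁰ K) (x : K) :
    x ∈ I ↔ ∃ y ∈ I.num, x = (y : K) / (I.den : 𝓞 K) := by
  have hd : ((I.den : 𝓞 K) : K) ≠ 0 := by simp
  have key := I.den_mul_self_eq_num
  have key' : ∀ z : K, z ∈ I.den • (I : Submodule (𝓞 K) K) ↔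
      z ∈ Submodule.map (Algebra.linearMap (𝓞 K) K) I.num := fun z => by rw [key]
  constructor
  · intro hx
    have h1 := (key' (I.den • x)).1 (Submodule.smul_mem_pointwise_smul _ _ _ hx)
    obtain ⟨y, hy, hyx⟩ := h1
    refine ⟨y, hy, ?_⟩
    rw [eq_div_iff hd, mul_comm]
    rw [Submonoid.smul_def, Algebra.smul_def] at hyx
    exact hyx.symm
  · rintro ⟨y, hy, rfl⟩
    obtain ⟨x, hx, hxy⟩ := (key' (y : K)).2 ⟨y, hy, rfl⟩
    have : (y : K) / (I.den : 𝓞 K) = x := by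
      rw [div_eq_iff hd, ← hxy, mul_comm]
      simp [Algebra.smul_def]
    rw [this]
    exact hx

namespace IsImaginaryQuadratic

variable {K : Type u} [Field K] [NumberField K] {D : ℤ} {δ : K} {σ : K ≃ₐ[ℚ] K}

/-- The conjugation of the ring of integers. -/
noncomputable def conjInt (σ : K ≃ₐ[ℚ] K) : 𝓞 K ≃ₐ[ℤ] 𝓞 K :=
  (RingOfIntegers.mapRingEquiv σ).toIntAlgEquiv

@[simp] theorem coe_conjInt (x : 𝓞 K) : (conjInt σ x : K) = σ x := rfl

theorem absNorm_map_conjInt (I : Ideal (𝓞 K)) :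
    Ideal.absNorm (I.map (conjInt σ)) = Ideal.absNorm I := by
  have h1 := Ideal.relNorm_map_algEquiv (R := ℤ) (conjInt σ) I
  rw [Ideal.relNorm_int, Ideal.relNorm_int] at h1
  have h2 := congrArg Ideal.absNorm h1
  simpa using h2

theorem coe_intNorm (h : IsImaginaryQuadratic D δ σ) (x : 𝓞 K) :
    ((Algebra.norm ℤ x : ℤ) : K) = x * σ x := by
  rw [h.mul_conj, ← Algebra.coe_norm_int]
  simp

/-- The absolute norm of an ideal is an integral combination of norms of its elements. -/
theorem absNorm_mem_span_norm_int (I : Ideal (𝓞 K)) :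
    (Ideal.absNorm I : ℤ) ∈ Submodule.span ℤ (Algebra.norm ℤ '' (I : Set (𝓞 K))) := by
  have h1 : (Ideal.absNorm I : ℤ) ∈ Ideal.relNorm ℤ I := by
    rw [Ideal.relNorm_int]; exact Ideal.mem_span_singleton_self _
  rw [Ideal.relNorm_apply] at h1
  simpa [Algebra.intNorm_eq_norm] using h1

/-- N(I) is an integral combination of products xσ(x) with x ∈ I, so it lies in I·σ(I). Both sides
have absolute norm N(I)², so the cofactor has norm 1 and the inclusion is an equality. -/
theorem mul_map_conjInt (h : IsImaginaryQuadratic D δ σ) (I : Ideal (𝓞 K)) :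
    I * I.map (conjInt σ) = Ideal.span {(Ideal.absNorm I : 𝓞 K)} := by
  by_cases hI : I = ⊥
  · simp [hI]
  have hle : Ideal.span {(Ideal.absNorm I : 𝓞 K)} ≤ I * I.map (conjInt σ) := by
    rw [Ideal.span_singleton_le_iff_mem]
    have h1 := absNorm_mem_span_norm_int I
    have h2 : ∀ m ∈ Submodule.span ℤ (Algebra.norm ℤ '' (I : Set (𝓞 K))),
        (m : 𝓞 K) ∈ I * I.map (conjInt σ) := by
      intro m hm
      induction hm using Submodule.span_induction with
      | mem m hm =>
        obtain ⟨x, hx, rfl⟩ := hm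
        have : ((Algebra.norm ℤ x : ℤ) : 𝓞 K) = x * conjInt σ x := by
          ext
          simpa using h.coe_intNorm x
        rw [this]
        exact Ideal.mul_mem_mul hx (Ideal.mem_map_of_mem _ hx)
      | zero => simp
      | add x y _ _ hx hy => push_cast; exact add_mem hx hy
      | smul c x _ hx =>
        rw [smul_eq_mul, Int.cast_mul]
        exact Ideal.mul_mem_left _ _ hx
    exact_mod_cast h2 _ h1
  obtain ⟨J, hJ⟩ := Ideal.dvd_iff_le.2 hle
  have hn : Ideal.absNorm I ≠ 0 := by simpa [Ideal.absNorm_eq_zero_iff] using hI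
  have h3 := congrArg Ideal.absNorm hJ
  rw [map_mul, map_mul, absNorm_map_conjInt, Ideal.absNorm_span_singleton] at h3
  have h4 : (Algebra.norm ℤ (Ideal.absNorm I : 𝓞 K)) = (Ideal.absNorm I : ℤ) ^ 2 := by
    have := Algebra.norm_algebraMap_of_basis (RingOfIntegers.basis K) (Ideal.absNorm I : ℤ)
    rw [← finrank_eq_card_basis (RingOfIntegers.basis K), RingOfIntegers.rank,
      h.finrank_eq_two] at this
    simpa using this
  rw [h4, Int.natAbs_pow, Int.natAbs_natCast, pow_two] at h3
  have h5 : Ideal.absNorm J = 1 := by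
    have : 0 < Ideal.absNorm I * Ideal.absNorm I := by positivity
    exact Nat.eq_of_mul_eq_mul_left this (by rw [← h3, mul_one])
  rw [Ideal.absNorm_eq_one_iff] at h5
  rw [hJ, h5, Ideal.mul_top]

theorem mul_conj_mem_of_mem_ideal (h : IsImaginaryQuadratic D δ σ) {I : Ideal (𝓞 K)} {x y : 𝓞 K}
    (hx : x ∈ I) (hy : y ∈ I) : ∃ c : 𝓞 K, (x : K) * σ y = Ideal.absNorm I * c := by
  have := Ideal.mul_mem_mul hx (Ideal.mem_map_of_mem (conjInt σ) hy)
  rw [h.mul_map_conjInt, Ideal.mem_span_singleton] at this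
  obtain ⟨c, hc⟩ := this
  refine ⟨c, ?_⟩
  have := congrArg (algebraMap (𝓞 K) K) hc
  simpa using this

theorem absNorm_eq_div_norm_den (h : IsImaginaryQuadratic D δ σ) (I : FractionalIdeal (𝓞 K)⁰ K) :
    FractionalIdeal.absNorm I = Ideal.absNorm I.num / Algebra.norm ℚ ((I.den : 𝓞 K) : K) := by
  have hd : ((I.den : 𝓞 K) : K) ≠ 0 := by simp
  have h1 : (Algebra.norm ℚ ((I.den : 𝓞 K) : K)) = (Algebra.norm ℤ (I.den : 𝓞 K) : ℤ) :=
    (Algebra.coe_norm_int _).symm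
  have h2 := h.norm_pos hd
  rw [FractionalIdeal.absNorm_eq, h1, Int.cast_abs, abs_of_pos (by rwa [← h1])]

/-- `x σ(y)` lies in `N(I) 𝓞 K` for `x, y ∈ I`. -/
theorem mul_conj_mem (h : IsImaginaryQuadratic D δ σ) {I : FractionalIdeal (𝓞 K)⁰ K} {x y : K}
    (hx : x ∈ I) (hy : y ∈ I) : ∃ c : 𝓞 K, x * σ y = (FractionalIdeal.absNorm I : ℚ) * c := by
  obtain ⟨a, ha, rfl⟩ := (FractionalIdeal.mem_iff_num_div_den I x).1 hx
  obtain ⟨b, hb, rfl⟩ := (FractionalIdeal.mem_iff_num_div_den I y).1 hy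
  obtain ⟨c, hc⟩ := h.mul_conj_mem_of_mem_ideal ha hb
  refine ⟨c, ?_⟩
  rw [h.absNorm_eq_div_norm_den, map_div₀, div_mul_div_comm, hc, h.mul_conj]
  push_cast
  ring

/-- The absolute norm of a fractional ideal is an integral combination of norms of elements. -/
theorem absNorm_mem_span_norm (h : IsImaginaryQuadratic D δ σ) (I : FractionalIdeal (𝓞 K)⁰ K) :
    FractionalIdeal.absNorm I ∈ Submodule.span ℤ (Algebra.norm ℚ '' {x : K | x ∈ I}) := by
  have h1 := absNorm_mem_span_norm_int I.num
  have h2 : ∀ m ∈ Submodule.span ℤ (Algebra.norm ℤ '' (I.num : Set (𝓞 K))),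
      (m : ℚ) / Algebra.norm ℚ ((I.den : 𝓞 K) : K) ∈
        Submodule.span ℤ (Algebra.norm ℚ '' {x : K | x ∈ I}) := by
    intro m hm
    induction hm using Submodule.span_induction with
    | mem m hm =>
      obtain ⟨x, hx, rfl⟩ := hm
      refine Submodule.subset_span ⟨(x : K) / (I.den : 𝓞 K), ?_, ?_⟩
      · exact (FractionalIdeal.mem_iff_num_div_den I _).2 ⟨x, hx, rfl⟩
      · rw [div_eq_mul_inv, map_mul, Algebra.norm_inv, Algebra.coe_norm_int, div_eq_mul_inv]
    | zero => simp
    | add x y _ _ hx hy => push_cast; rw [add_div]; exact add_mem hx hy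
    | smul c x _ hx =>
      have e : ((c • x : ℤ) : ℚ) / Algebra.norm ℚ ((I.den : 𝓞 K) : K)
          = c • ((x : ℚ) / Algebra.norm ℚ ((I.den : 𝓞 K) : K)) := by
        simp [mul_div_assoc]
      rw [e]
      exact Submodule.smul_mem _ _ hx
  rw [h.absNorm_eq_div_norm_den]
  exact_mod_cast h2 _ h1

theorem absNorm_pos (I : (FractionalIdeal (𝓞 K)⁰ K)ˣ) :
    0 < FractionalIdeal.absNorm (I : FractionalIdeal (𝓞 K)⁰ K) := by
  refine lt_of_le_of_ne (FractionalIdeal.absNorm_nonneg _) (Ne.symm ?_)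
  rw [ne_eq, FractionalIdeal.absNorm_eq_zero_iff]
  exact I.ne_zero

/-- The norm of an element of `I` is an integral multiple of the norm of `I`. -/
theorem exists_norm_eq_mul (h : IsImaginaryQuadratic D δ σ) (I : (FractionalIdeal (𝓞 K)⁰ K)ˣ) {x : K}
    (hx : x ∈ (I : FractionalIdeal (𝓞 K)⁰ K)) :
    ∃ m : ℤ, Algebra.norm ℚ x = m * FractionalIdeal.absNorm (I : FractionalIdeal (𝓞 K)⁰ K) := by
  obtain ⟨c, hc⟩ := h.mul_conj_mem hx hx
  have hI := (absNorm_pos I).ne'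
  set N := FractionalIdeal.absNorm (I : FractionalIdeal (𝓞 K)⁰ K)
  have hN : (N : K) ≠ 0 := by exact_mod_cast hI
  rw [h.mul_conj] at hc
  have hc' : (c : K) = (Algebra.norm ℚ x / N : ℚ) := by
    push_cast
    rw [hc]
    field_simp
  have h1 : IsIntegral ℤ ((Algebra.norm ℚ x / N : ℚ) : K) := hc' ▸ c.isIntegral_coe
  obtain ⟨m, hm⟩ := exists_intCast_of_isIntegral h1
  exact ⟨m, by rw [← hm]; field_simp⟩

/-- A fractional ideal `I` has an element whose norm is an odd multiple of the norm of `I`. -/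
theorem exists_odd_norm (h : IsImaginaryQuadratic D δ σ) (I : (FractionalIdeal (𝓞 K)⁰ K)ˣ) :
    ∃ x ∈ (I : FractionalIdeal (𝓞 K)⁰ K), ∃ m : ℤ, Odd m ∧
      Algebra.norm ℚ x = m * FractionalIdeal.absNorm (I : FractionalIdeal (𝓞 K)⁰ K) := by
  -- If all norms from I were even multiples of N(I), then N(I), an integral combination of them,
  -- would be an even multiple of itself.
  by_contra! hcon
  have hI := (absNorm_pos I).ne'
  have h1 := h.absNorm_mem_span_norm (I : FractionalIdeal (𝓞 K)⁰ K)
  set N := FractionalIdeal.absNorm (I : FractionalIdeal (𝓞 K)⁰ K) with hN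
  have h2 : ∀ q ∈ Submodule.span ℤ (Algebra.norm ℚ '' {x : K | x ∈ (I : FractionalIdeal (𝓞 K)⁰ K)}),
      ∃ k : ℤ, q = 2 * k * N := by
    intro q hq
    induction hq using Submodule.span_induction with
    | mem q hq =>
      obtain ⟨x, hx, rfl⟩ := hq
      obtain ⟨m, hm⟩ := h.exists_norm_eq_mul I hx
      have hm2 : ¬ Odd m := fun ho => hcon x hx m ho hm
      obtain ⟨k, rfl⟩ := Int.not_odd_iff_even.1 hm2
      exact ⟨k, by rw [hm]; push_cast; ring⟩
    | zero => exact ⟨0, by simp⟩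
    | add x y _ _ hx hy =>
      obtain ⟨a, rfl⟩ := hx
      obtain ⟨b, rfl⟩ := hy
      exact ⟨a + b, by push_cast; ring⟩
    | smul c x _ hx =>
      obtain ⟨a, rfl⟩ := hx
      exact ⟨c * a, by simp; ring⟩
  obtain ⟨k, hk⟩ := h2 _ h1
  have : (1 : ℚ) = 2 * k := by
    field_simp at hk
    exact hk
  have : (1 : ℤ) = 2 * k := by exact_mod_cast this
  omega

/-- The product of a fractional ideal with its conjugate is generated by its norm. -/
theorem mul_span_conj (h : IsImaginaryQuadratic D δ σ) (I : FractionalIdeal (𝓞 K)⁰ K) :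
    (I : Submodule (𝓞 K) K) * Submodule.span (𝓞 K) (σ '' {a : K | a ∈ I}) =
      Submodule.span (𝓞 K) {((FractionalIdeal.absNorm I : ℚ) : K)} := by
  apply le_antisymm
  · rw [← Submodule.span_eq (I : Submodule (𝓞 K) K), Submodule.span_mul_span, Submodule.span_le]
    rintro _ ⟨x, hx, _, ⟨y, hy, rfl⟩, rfl⟩
    obtain ⟨c, hc⟩ := h.mul_conj_mem hx hy
    refine Submodule.mem_span_singleton.2 ⟨c, ?_⟩
    rw [Algebra.smul_def, mul_comm]
    exact hc.symm
  · rw [Submodule.span_singleton_le_iff_mem]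
    have h2 : ∀ q ∈ Submodule.span ℤ (Algebra.norm ℚ '' {x : K | x ∈ I}), (q : K) ∈
        (I : Submodule (𝓞 K) K) * Submodule.span (𝓞 K) (σ '' {a : K | a ∈ I}) := by
      intro q hq
      induction hq using Submodule.span_induction with
      | mem q hq =>
        obtain ⟨x, hx, rfl⟩ := hq
        rw [← h.mul_conj]
        exact Submodule.mul_mem_mul hx (Submodule.subset_span ⟨x, hx, rfl⟩)
      | zero => simp
      | add x y _ _ hx hy => push_cast; exact add_mem hx hy
      | smul c x _ hx =>
        have e : ((c • x : ℚ) : K) = c • (x : K) := by simp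
        rw [e]
        exact zsmul_mem hx c
    exact h2 _ (h.absNorm_mem_span_norm I)

end IsImaginaryQuadratic

/-! ### Even hermitian matrices over `ℤ√D` and their determinants modulo 4. -/

/-- A division-free form of the Schur complement formula. -/
theorem Matrix.det_pow_mul_det_fromBlocks {R m n : Type*} [CommRing R] [Fintype m] [DecidableEq m]
    [Fintype n] [DecidableEq n] (A : Matrix m m R) (B : Matrix m n R) (C : Matrix n m R)
    (E : Matrix n n R) :
    A.det ^ Fintype.card n * (Matrix.fromBlocks A B C E).det =
      A.det * (A.det • E - C * A.adjugate * B).det := by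
  -- Block elimination with the adjugate in place of the inverse, so that everything stays over a
  -- ring in which `A.det` need not be a unit.
  have h : Matrix.fromBlocks 1 0 (-(C * A.adjugate)) (A.det • 1) * Matrix.fromBlocks A B C E =
      Matrix.fromBlocks A B 0 (A.det • E - C * A.adjugate * B) := by
    rw [Matrix.fromBlocks_multiply]
    congr 1
    · simp
    · simp
    · rw [Matrix.neg_mul, Matrix.mul_assoc, Matrix.adjugate_mul]
      simp
    · rw [Matrix.neg_mul, Matrix.smul_mul, Matrix.one_mul, neg_add_eq_sub]
  have h2 := congrArg Matrix.det h
  rw [Matrix.det_mul, Matrix.det_fromBlocks_zero₁₂, Matrix.det_fromBlocks_zero₂₁, Matrix.det_smul,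
    Matrix.det_one, Matrix.det_one, one_mul, mul_one] at h2
  exact h2

namespace Zsqrtd

variable {D : ℤ}

/-- The residue map of `ℤ√D` at the prime above `2`. -/
def residue (D : ℤ) : ℤ√D →+* ZMod 2 :=
  -- √D may be sent to D itself, because every element of `ZMod 2` is its own square.
  Zsqrtd.lift ⟨(D : ZMod 2), by
    generalize (D : ZMod 2) = x
    revert x
    decide⟩

theorem residue_apply (z : ℤ√D) : residue D z = z.re + z.im * D := rfl

/-- Squares and signs do not matter in `ZMod 2`, so x² - Dy² reduces to x + Dy. -/
theorem residue_eq_zero_iff (z : ℤ√D) : residue D z = 0 ↔ Even z.norm := by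
  have h : ((z.norm : ℤ) : ZMod 2) = residue D z := by
    rw [residue_apply, norm_def]
    push_cast
    generalize (z.re : ZMod 2) = x
    generalize (z.im : ZMod 2) = y
    generalize (D : ZMod 2) = d
    revert x y d
    decide
  rw [← h, ZMod.intCast_eq_zero_iff_even]

/-- A hermitian matrix over `ℤ√D` with even diagonal. -/
structure IsEvenHermitian {n : Type*} (G : Matrix n n (ℤ√D)) : Prop where
  star_apply : ∀ i j, star (G i j) = G j i
  even_diag : ∀ i, ∃ c : ℤ, G i i = ((2 * c : ℤ) : ℤ√D)

theorem IsEvenHermitian.submatrix {m n : Type*} {G : Matrix n n (ℤ√D)} (hG : IsEvenHermitian G)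
    (f : m → n) : IsEvenHermitian (G.submatrix f f) :=
  ⟨fun _ _ => hG.star_apply _ _, fun _ => hG.even_diag _⟩

theorem add_star (z : ℤ√D) : z + star z = ((2 * z.re : ℤ) : ℤ√D) := by
  ext
  · simp; ring
  · simp

/-- The scaled Schur complement of a binary block in an even hermitian matrix is even hermitian. -/
theorem IsEvenHermitian.schur {n : Type*} {G : Matrix (Fin 2 ⊕ n) (Fin 2 ⊕ n) (ℤ√D)}
    (hG : IsEvenHermitian G) :
    IsEvenHermitian (G.toBlocks₁₁.det • G.toBlocks₂₂ -
      G.toBlocks₂₁ * G.toBlocks₁₁.adjugate * G.toBlocks₁₂) := by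
  obtain ⟨a, ha⟩ := hG.even_diag (Sum.inl 0)
  obtain ⟨c, hc⟩ := hG.even_diag (Sum.inl 1)
  have hdet : G.toBlocks₁₁.det =
      ((2 * a * (2 * c) - (G (Sum.inl 0) (Sum.inl 1)).norm : ℤ) : ℤ√D) := by
    rw [Matrix.det_fin_two]
    simp only [Matrix.toBlocks₁₁, Matrix.of_apply]
    rw [ha, hc, ← hG.star_apply (Sum.inl 0) (Sum.inl 1)]
    push_cast
    rw [norm_eq_mul_conj]
  have hent : ∀ i j, (G.toBlocks₁₁.det • G.toBlocks₂₂ -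
      G.toBlocks₂₁ * G.toBlocks₁₁.adjugate * G.toBlocks₁₂) i j =
      ((2 * a * (2 * c) - (G (Sum.inl 0) (Sum.inl 1)).norm : ℤ) : ℤ√D) * G (Sum.inr i) (Sum.inr j)
      - (G (Sum.inr i) (Sum.inl 0) * ((2 * c : ℤ) : ℤ√D) * G (Sum.inl 0) (Sum.inr j)
        + G (Sum.inr i) (Sum.inl 1) * ((2 * a : ℤ) : ℤ√D) * G (Sum.inl 1) (Sum.inr j)
        - (G (Sum.inr i) (Sum.inl 0) * G (Sum.inl 0) (Sum.inl 1) * G (Sum.inl 1) (Sum.inr j)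
          + G (Sum.inr i) (Sum.inl 1) * G (Sum.inl 1) (Sum.inl 0) * G (Sum.inl 0) (Sum.inr j))) := by
    intro i j
    rw [hdet, Matrix.sub_apply, Matrix.smul_apply, Matrix.mul_apply, Fin.sum_univ_two,
      Matrix.mul_apply, Matrix.mul_apply, Fin.sum_univ_two, Fin.sum_univ_two,
      Matrix.adjugate_fin_two]
    simp only [Matrix.toBlocks₁₁, Matrix.toBlocks₂₁, Matrix.toBlocks₁₂, Matrix.toBlocks₂₂,
      Matrix.of_apply, Matrix.cons_val', Matrix.cons_val_zero, Matrix.cons_val_one,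
      Matrix.cons_val_fin_one, smul_eq_mul]
    rw [ha, hc]
    ring
  have hint : ∀ k : ℤ, star ((k : ℤ√D)) = k := fun k => by ext <;> simp
  constructor
  · intro i j
    rw [hent, hent]
    simp only [star_sub, star_add, star_mul', hint, hG.star_apply]
    ring
  · intro i
    obtain ⟨e, he⟩ := hG.even_diag (Sum.inr i)
    set x := G (Sum.inr i) (Sum.inl 0) with hx
    set y := G (Sum.inr i) (Sum.inl 1) with hy
    set b := G (Sum.inl 0) (Sum.inl 1) with hb
    have e1 : G (Sum.inl 0) (Sum.inr i) = star x := by rw [hx, hG.star_apply]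
    have e2 : G (Sum.inl 1) (Sum.inr i) = star y := by rw [hy, hG.star_apply]
    have e3 : G (Sum.inl 1) (Sum.inl 0) = star b := by rw [hb, hG.star_apply]
    -- Half of the diagonal entry: the terms with x·star x and y·star y carry the even diagonal
    -- entries 2c and 2a of the block, and the two mixed terms are conjugate, so their sum is twice
    -- a real part.
    refine ⟨(2 * a * (2 * c) - b.norm) * e - (c * x.norm + a * y.norm - (x * b * star y).re), ?_⟩
    rw [hent, e1, e2, e3, he]
    have e4 : x * b * star y + y * star b * star x = ((2 * (x * b * star y).re : ℤ) : ℤ√D) := by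
      rw [← add_star]
      simp only [star_mul', star_star]
      ring
    rw [e4]
    push_cast
    rw [norm_eq_mul_conj x, norm_eq_mul_conj y]
    ring

/-- Modulo 4 the norm form becomes x² + y², which takes only the values 0, 1 and 2. -/
theorem norm_modEq_one {z : ℤ√D} (hD : D ≡ 3 [ZMOD 4]) (hz : Odd z.norm) :
    z.norm ≡ 1 [ZMOD 4] := by
  rw [norm_def] at *
  simp only [Int.ModEq] at *
  rcases Int.even_or_odd' z.re with ⟨a, ha | ha⟩ <;> rcases Int.even_or_odd' z.im with ⟨b, hb | hb⟩
    <;> rw [ha, hb] at hz ⊢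
  · exfalso
    rw [show 2 * a * (2 * a) - D * (2 * b) * (2 * b) = 2 * (2 * (a * a) - D * b * (2 * b)) by ring,
      Int.odd_iff] at hz
    omega
  · rw [show 2 * a * (2 * a) - D * (2 * b + 1) * (2 * b + 1)
      = 4 * (a * a - D * (b * b + b)) - D by ring]
    omega
  · rw [show (2 * a + 1) * (2 * a + 1) - D * (2 * b) * (2 * b)
      = 4 * (a * a + a - D * (b * b)) + 1 by ring]
    omega
  · exfalso
    rw [show (2 * a + 1) * (2 * a + 1) - D * (2 * b + 1) * (2 * b + 1)
      = 4 * (a * a + a - D * (b * b + b)) + 1 - D by ring, Int.odd_iff] at hz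
    omega

/-- An even hermitian matrix of odd determinant has even size, and its determinant
is `(-1)^(n/2)` modulo `4` if `D ≡ 3 (mod 4)`. -/
theorem IsEvenHermitian.even_and_det_modEq : ∀ (n : ℕ) {G : Matrix (Fin n) (Fin n) (ℤ√D)}
    (_ : IsEvenHermitian G) {d : ℤ} (_ : G.det = d) (_ : Odd d),
    Even n ∧ (D ≡ 3 [ZMOD 4] → d ≡ (-1) ^ (n / 2) [ZMOD 4])
  | 0, G, hG, d, hd, _ => by
    have : d = 1 := by
      have : (d : ℤ√D) = 1 := by rw [← hd]; simp
      exact_mod_cast this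
    subst this
    exact ⟨Even.zero, fun _ => rfl⟩
  | 1, G, hG, d, hd, hodd => by
    exfalso
    obtain ⟨c, hc⟩ := hG.even_diag 0
    rw [Matrix.det_fin_one, hc] at hd
    have : 2 * c = d := by exact_mod_cast hd
    rw [← this, Int.odd_iff] at hodd
    omega
  | n + 2, G, hG, d, hd, hodd => by
    -- A row vanishing modulo the prime above 2 would make the determinant even. The entry found is
    -- off the diagonal, since diagonal entries are even. It is then moved into the leading binary
    -- block.
    obtain ⟨j, hj⟩ : ∃ j, residue D (G 0 j) ≠ 0 := by
      by_contra! hall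
      have h0 : residue D G.det = 0 := by
        rw [RingHom.map_det]
        refine Matrix.det_eq_zero_of_row_eq_zero 0 fun j => ?_
        simpa using hall j
      rw [hd, map_intCast, ZMod.intCast_eq_zero_iff_even] at h0
      exact (Int.not_even_iff_odd.2 hodd) h0
    have hj0 : (0 : Fin (n + 2)) ≠ j := by
      rintro rfl
      obtain ⟨c, hc⟩ := hG.even_diag 0
      refine hj ?_
      rw [hc, map_intCast, ZMod.intCast_eq_zero_iff_even]
      simp
    let e₀ : Fin 2 ⊕ Fin n ≃ Fin (n + 2) := finSumFinEquiv.trans (finCongr (add_comm 2 n))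
    let e : Fin 2 ⊕ Fin n ≃ Fin (n + 2) := e₀.trans (Equiv.swap (e₀ (Sum.inl 1)) j)
    have he0 : e (Sum.inl 0) = 0 := by
      have h0 : e₀ (Sum.inl 0) = 0 := by
        ext
        simp [e₀]
      have h1 : e₀ (Sum.inl 0) ≠ e₀ (Sum.inl 1) := by simp
      rw [h0] at h1
      simp only [e, Equiv.trans_apply, h0]
      exact Equiv.swap_apply_of_ne_of_ne h1 hj0
    have he1 : e (Sum.inl 1) = j := by simp [e]
    set G' := G.submatrix e e with hG'
    have hG'e : IsEvenHermitian G' := hG.submatrix e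
    have hdet : G'.det = d := by rw [hG', Matrix.det_submatrix_equiv_self, hd]
    obtain ⟨a, ha⟩ := hG'e.even_diag (Sum.inl 0)
    obtain ⟨c, hc⟩ := hG'e.even_diag (Sum.inl 1)
    have hb : Odd (G' (Sum.inl 0) (Sum.inl 1)).norm := by
      have : G' (Sum.inl 0) (Sum.inl 1) = G 0 j := by simp [hG', he0, he1]
      rw [this, ← Int.not_even_iff_odd, ← residue_eq_zero_iff]
      exact hj
    set b := G' (Sum.inl 0) (Sum.inl 1) with hb'
    have hA : G'.toBlocks₁₁.det = ((2 * a * (2 * c) - b.norm : ℤ) : ℤ√D) := by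
      rw [Matrix.det_fin_two]
      simp only [Matrix.toBlocks₁₁, Matrix.of_apply]
      rw [ha, hc, ← hG'e.star_apply (Sum.inl 0) (Sum.inl 1)]
      push_cast
      rw [norm_eq_mul_conj]
    have hschur := Matrix.det_pow_mul_det_fromBlocks G'.toBlocks₁₁ G'.toBlocks₁₂ G'.toBlocks₂₁
      G'.toBlocks₂₂
    rw [Matrix.fromBlocks_toBlocks, hdet, Fintype.card_fin] at hschur
    have hS := hG'e.schur
    set S := G'.toBlocks₁₁.det • G'.toBlocks₂₂ - G'.toBlocks₂₁ * G'.toBlocks₁₁.adjugate *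
      G'.toBlocks₁₂
    rw [hA] at hschur
    set k : ℤ := 2 * a * (2 * c) - b.norm with hk
    have hkodd : Odd k := by
      rw [hk, mul_assoc]
      exact (even_two_mul _).sub_odd hb
    have hk0 : k ≠ 0 := by
      rintro h0
      rw [h0] at hkodd
      simp at hkodd
    -- The Schur identity reads kⁿd = k·det S with a nonzero integer k, so det S has no √D-part.
    obtain ⟨s, hs⟩ : ∃ s : ℤ, S.det = s := by
      have him : (k : ℤ√D) * S.det = ((k ^ n * d : ℤ) : ℤ√D) := by rw [← hschur]; push_cast; ring
      refine ⟨S.det.re, ?_⟩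
      ext
      · simp
      · have := congrArg Zsqrtd.im him
        simp only [im_smul, im_intCast, mul_eq_zero, hk0, false_or] at this
        simpa using this
    have hint : k ^ n * d = k * s := by
      rw [hs] at hschur
      exact_mod_cast hschur
    have hsodd : Odd s := by
      have : Odd (k * s) := by rw [← hint]; exact (hkodd.pow).mul hodd
      exact (Int.odd_mul.1 this).2
    obtain ⟨hn, hmod⟩ := IsEvenHermitian.even_and_det_modEq n hS hs hsodd
    refine ⟨hn.add even_two, fun hD => ?_⟩
    have hs4 := hmod hD
    -- Here k = 4ac - N(b) with N(b) ≡ 1. As n is even, kⁿ ≡ 1, hence d ≡ ks ≡ -s: each block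
    -- contributes one sign.
    have hk4 : k ≡ -1 [ZMOD 4] := by
      have := norm_modEq_one hD hb
      simp only [Int.ModEq] at this ⊢
      rw [hk, show 2 * a * (2 * c) = 4 * (a * c) by ring]
      omega
    have hkn : k ^ n ≡ 1 [ZMOD 4] := by
      have := hk4.pow n
      rwa [hn.neg_one_pow] at this
    have h1 : d ≡ k * s [ZMOD 4] := by
      rw [← hint]
      simpa using (hkn.mul_right d).symm
    have h2 : k * s ≡ -1 * (-1) ^ (n / 2) [ZMOD 4] := hk4.mul hs4
    have h3 : (n + 2) / 2 = n / 2 + 1 := by omega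
    rw [h3, pow_succ, mul_comm]
    exact h1.trans h2

end Zsqrtd

/-! ### The norm form x² - Dy² over the 2-adic numbers. -/

namespace Padic

/-- An integer `u ≡ 1 (mod 8)` is a square in `ℚ_2`. -/
theorem exists_sq_eq_of_modEq {u : ℤ} (hu : u ≡ 1 [ZMOD 8]) : ∃ a : ℚ_[2], a ^ 2 = u := by
  obtain ⟨k, hk⟩ := Int.modEq_iff_dvd.1 hu.symm
  -- Writing the root as 1 + 2z turns the equation for u = 1 + 8k into z² + z = 2k, whose derivative
  -- at 0 is a unit, so Hensel's lemma applies.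
  let F : Polynomial ℤ_[2] := Polynomial.X ^ 2 + Polynomial.X - Polynomial.C (2 * k : ℤ_[2])
  have hF : ∀ z : ℤ_[2], Polynomial.aeval z F = z ^ 2 + z - 2 * k := fun z => by simp [F]
  have hF' : Polynomial.aeval (0 : ℤ_[2]) (Polynomial.derivative F) = 1 := by simp [F]
  have hnorm : ‖Polynomial.aeval (0 : ℤ_[2]) F‖ <
      ‖Polynomial.aeval (0 : ℤ_[2]) (Polynomial.derivative F)‖ ^ 2 := by
    rw [hF, hF']
    have h2 : ‖(2 : ℤ_[2])‖ < 1 := by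
      have := PadicInt.norm_p (p := 2)
      norm_num at this
      rw [this]; norm_num
    simp only [ne_eq, OfNat.ofNat_ne_zero, not_false_eq_true, zero_pow, add_zero, zero_sub,
      norm_neg, norm_mul, norm_one, one_pow]
    exact mul_lt_one_of_nonneg_of_lt_one_left (norm_nonneg _) h2 (PadicInt.norm_le_one _)
  obtain ⟨z, hz, -⟩ := hensels_lemma hnorm
  rw [hF] at hz
  refine ⟨((1 + 2 * z : ℤ_[2]) : ℚ_[2]), ?_⟩
  have hu' : u = 1 + 8 * k := by linarith
  have : (1 + 2 * z) ^ 2 = (u : ℤ_[2]) := by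
    rw [hu']
    push_cast
    linear_combination 4 * hz
  exact_mod_cast congrArg (fun x : ℤ_[2] => (x : ℚ_[2])) this

theorem two_dvd_of_toZModPow {x : ℤ_[2]}
    (hx : PadicInt.toZModPow 2 x = 0 ∨ PadicInt.toZModPow 2 x = 2) : ∃ y, x = 2 * y := by
  have aux : ∀ w : ℤ_[2], PadicInt.toZModPow 2 w = 0 → ∃ y, w = 4 * y := by
    intro w hw
    rw [← RingHom.mem_ker, PadicInt.ker_toZModPow, Ideal.mem_span_singleton] at hw
    obtain ⟨y, hy⟩ := hw
    exact ⟨y, by rw [hy]; norm_num⟩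
  rcases hx with hx | hx
  · obtain ⟨y, rfl⟩ := aux x hx
    exact ⟨2 * y, by ring⟩
  · obtain ⟨y, hy⟩ := aux (x - 2) (by rw [map_sub, hx, map_ofNat, sub_self])
    exact ⟨2 * y + 1, by linear_combination hy⟩

/-- Modulo 4 the left side is x² + y², which is never 3 and vanishes only if x and y are even.
Dividing both by 2 lowers k, so descent applies. The factor 4ᵏ accounts for denominators cleared
from a 2-adic solution. -/
theorem sq_sub_mul_sq_ne_int {D m : ℤ} (hD : D ≡ 3 [ZMOD 4]) (hm : m ≡ 3 [ZMOD 4]) (k : ℕ)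
    (x y : ℤ_[2]) : x ^ 2 - D * y ^ 2 ≠ 4 ^ k * m := by
  have hD' : ((D : ℤ) : ZMod (2 ^ 2)) = 3 := by
    have := (ZMod.intCast_eq_intCast_iff D 3 4).2 hD
    exact_mod_cast this
  have hm' : ((m : ℤ) : ZMod (2 ^ 2)) = 3 := by
    have := (ZMod.intCast_eq_intCast_iff m 3 4).2 hm
    exact_mod_cast this
  induction k generalizing x y with
  | zero =>
    intro h
    have h1 := congrArg (PadicInt.toZModPow 2) h
    simp only [map_sub, map_mul, map_pow, map_intCast, pow_zero, one_mul] at h1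
    rw [hD', hm'] at h1
    generalize PadicInt.toZModPow 2 x = X at h1
    generalize PadicInt.toZModPow 2 y = Y at h1
    revert X Y
    decide
  | succ k ih =>
    intro h
    have h1 := congrArg (PadicInt.toZModPow 2) h
    simp only [map_sub, map_mul, map_pow, map_intCast, map_ofNat] at h1
    have h40 : (4 : ZMod (2 ^ 2)) = 0 := by decide
    rw [hD', h40, zero_pow (Nat.succ_ne_zero k), zero_mul] at h1
    have key : ∀ X Y : ZMod (2 ^ 2), X ^ 2 - 3 * Y ^ 2 = 0 → (X = 0 ∨ X = 2) ∧ (Y = 0 ∨ Y = 2) := by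
      decide
    obtain ⟨hx, hy⟩ := key _ _ h1
    obtain ⟨x, rfl⟩ := two_dvd_of_toZModPow hx
    obtain ⟨y, rfl⟩ := two_dvd_of_toZModPow hy
    refine ih x y ?_
    have h4 : (4 : ℤ_[2]) ≠ 0 := by norm_num
    refine mul_left_cancel₀ h4 ?_
    rw [pow_succ] at h
    linear_combination h

theorem exists_two_pow_mul_mem (q : ℚ_[2]) : ∃ k : ℕ, ∀ l ≥ k, ‖2 ^ l * q‖ ≤ 1 := by
  obtain ⟨k, hk⟩ := pow_unbounded_of_one_lt ‖q‖ (one_lt_two)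
  refine ⟨k, fun l hl => ?_⟩
  have h2 : ‖(2 : ℚ_[2])‖ = 2⁻¹ := by simpa using Padic.norm_p (p := 2)
  rw [norm_mul, norm_pow, h2, inv_pow, inv_mul_le_iff₀ (by positivity), mul_one]
  exact hk.le.trans (pow_le_pow_right₀ one_le_two hl)

theorem sq_sub_mul_sq_ne {D m : ℤ} (hD : D ≡ 3 [ZMOD 4]) (hm : m ≡ 3 [ZMOD 4])
    (x y : ℚ_[2]) : x ^ 2 - D * y ^ 2 ≠ m := by
  intro h
  obtain ⟨k, hk⟩ := exists_two_pow_mul_mem x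
  obtain ⟨l, hl⟩ := exists_two_pow_mul_mem y
  obtain ⟨x', hx'⟩ : ∃ x' : ℤ_[2], (x' : ℚ_[2]) = 2 ^ max k l * x :=
    ⟨⟨_, hk _ (le_max_left k l)⟩, rfl⟩
  obtain ⟨y', hy'⟩ : ∃ y' : ℤ_[2], (y' : ℚ_[2]) = 2 ^ max k l * y :=
    ⟨⟨_, hl _ (le_max_right k l)⟩, rfl⟩
  refine sq_sub_mul_sq_ne_int hD hm (max k l) x' y' ?_
  have key : (x' : ℚ_[2]) ^ 2 - D * (y' : ℚ_[2]) ^ 2 = 4 ^ max k l * m := by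
    rw [hx', hy', show (4 : ℚ_[2]) = 2 ^ 2 by norm_num, ← pow_mul, mul_comm 2, pow_mul, ← h]
    ring
  apply PadicInt.ext
  push_cast
  exact key

/-- For `D ≡ 3 (mod 4)` the integers `m ≡ 1 (mod 4)` are norms from `ℚ_2(√D)`. -/
theorem exists_sq_sub_mul_sq {D m : ℤ} (hD : D ≡ 3 [ZMOD 4]) (hm : m ≡ 1 [ZMOD 4]) :
    ∃ x y : ℚ_[2], x ^ 2 - D * y ^ 2 = m := by
  -- Since D is odd, 4D ≡ 4 (mod 8). If m ≡ 5, taking y = 2 leaves x² = m + 4D ≡ 1 (mod 8), which is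
  -- solvable.
  have : m ≡ 1 [ZMOD 8] ∨ m + 4 * D ≡ 1 [ZMOD 8] := by
    simp only [Int.ModEq] at *
    omega
  rcases this with h | h
  · obtain ⟨a, ha⟩ := exists_sq_eq_of_modEq h
    exact ⟨a, 0, by rw [ha]; ring⟩
  · obtain ⟨a, ha⟩ := exists_sq_eq_of_modEq h
    exact ⟨a, 2, by rw [ha]; push_cast; ring⟩

end Padic

namespace IsImaginaryQuadratic

variable {K : Type u} [Field K] [NumberField K] {D : ℤ} {δ : K} {σ : K ≃ₐ[ℚ] K}

theorem norm_padic (h : IsImaginaryQuadratic D δ σ) (x y : ℚ_[2]) :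
    Algebra.norm ℚ_[2] (x ⊗ₜ[ℚ] (1 : K) + y ⊗ₜ[ℚ] δ) = x ^ 2 - D * y ^ 2 := by
  have := Algebra.norm_eq_of_basis_one_sqrt (Algebra.TensorProduct.basis ℚ_[2] h.basis)
    (d := (D : ℚ_[2])) (by simp [Algebra.TensorProduct.one_def]) (by
      rw [Algebra.TensorProduct.basis_apply, basis_one, Algebra.TensorProduct.tmul_pow, h.sq]
      simp only [one_pow, map_intCast]
      have e : (D : K) = (D : ℚ) • (1 : K) := by simp [Algebra.smul_def]
      rw [e, TensorProduct.tmul_smul, ← Algebra.TensorProduct.one_def]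
      simp [Algebra.smul_def]) x y
  simpa [TensorProduct.smul_tmul'] using this

theorem exists_repr_padic (h : IsImaginaryQuadratic D δ σ) (z : ℚ_[2] ⊗[ℚ] K) :
    ∃ x y : ℚ_[2], z = x ⊗ₜ[ℚ] (1 : K) + y ⊗ₜ[ℚ] δ := by
  have := (Algebra.TensorProduct.basis ℚ_[2] h.basis).sum_repr z
  rw [Fin.sum_univ_two] at this
  refine ⟨(Algebra.TensorProduct.basis ℚ_[2] h.basis).repr z 0,
    (Algebra.TensorProduct.basis ℚ_[2] h.basis).repr z 1, ?_⟩
  nth_rewrite 1 [← this]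
  simp only [Algebra.TensorProduct.basis_apply, TensorProduct.smul_tmul', smul_eq_mul, mul_one,
    basis_zero, basis_one]

theorem isUnit_padic (h : IsImaginaryQuadratic D δ σ) {x y : ℚ_[2]} (hxy : x ^ 2 - D * y ^ 2 ≠ 0) :
    IsUnit (x ⊗ₜ[ℚ] (1 : K) + y ⊗ₜ[ℚ] δ) := by
  have e : (x ⊗ₜ[ℚ] (1 : K) + y ⊗ₜ[ℚ] δ) * (x ⊗ₜ[ℚ] (1 : K) + (-y) ⊗ₜ[ℚ] δ) =
      algebraMap ℚ_[2] (ℚ_[2] ⊗[ℚ] K) (x ^ 2 - D * y ^ 2) := by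
    have e1 : (D : K) = (D : ℚ) • (1 : K) := by simp [Algebra.smul_def]
    simp only [add_mul, mul_add, Algebra.TensorProduct.tmul_mul_tmul, one_mul, mul_one,
      show δ * δ = (D : K) by rw [← pow_two, h.sq]]
    rw [e1, TensorProduct.tmul_smul, TensorProduct.smul_tmul',
      Algebra.TensorProduct.algebraMap_apply, Algebra.smul_def]
    simp only [mul_neg, map_intCast, TensorProduct.neg_tmul, mul_comm y x, Algebra.algebraMap_self,
      RingHom.id_apply, TensorProduct.sub_tmul, pow_two]
    abel
  exact isUnit_of_mul_isUnit_left (e ▸ (IsUnit.mk0 _ hxy).map (algebraMap _ _))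

/-- The norm residue symbol at `2` for `D ≡ 3 (mod 4)`, on odd integers times global norms. -/
theorem normResidueSymbol_two (h : IsImaginaryQuadratic D δ σ) (hD : D ≡ 3 [ZMOD 4]) {m : ℤ}
    (hm : Odd m) {γ : K} (hγ : γ ≠ 0) :
    normResidueSymbol K 2 (((m * Algebra.norm ℚ γ : ℚ)) : ℚ_[2]) =
      if m ≡ 1 [ZMOD 4] then 1 else -1 := by
  obtain ⟨a, b, rfl⟩ := h.exists_repr γ
  have hpos := h.norm_pos hγ
  rw [h.norm_eq] at hpos ⊢
  have hN : ((a : ℚ_[2]) ^ 2 - D * (b : ℚ_[2]) ^ 2) ≠ 0 := by exact_mod_cast hpos.ne'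
  rw [normResidueSymbol]
  by_cases hm1 : m ≡ 1 [ZMOD 4]
  · rw [if_pos hm1, if_pos]
    obtain ⟨x, y, hxy⟩ := Padic.exists_sq_sub_mul_sq hD hm1
    have hm0 : (m : ℚ_[2]) ≠ 0 := by
      have : m ≠ 0 := by rintro rfl; simp at hm
      exact_mod_cast this
    refine ⟨((h.isUnit_padic (hxy.trans_ne hm0)).mul (h.isUnit_padic hN)).unit, ?_⟩
    rw [IsUnit.unit_spec, map_mul, h.norm_padic, h.norm_padic, hxy]
    push_cast
    rfl
  · rw [if_neg hm1, if_neg]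
    have hm3 : m ≡ 3 [ZMOD 4] := by
      rw [Int.odd_iff] at hm
      simp only [Int.ModEq] at *
      omega
    -- Dividing z by the image of γ would give an element of norm m ≡ 3 (mod 4).
    rintro ⟨z, hz⟩
    obtain ⟨u, hu⟩ := (h.isUnit_padic hN)
    have hnu : Algebra.norm ℚ_[2] (u : ℚ_[2] ⊗[ℚ] K) = (a : ℚ_[2]) ^ 2 - D * (b : ℚ_[2]) ^ 2 := by
      rw [hu, h.norm_padic]
    have hinv : Algebra.norm ℚ_[2] ((u⁻¹ : (ℚ_[2] ⊗[ℚ] K)ˣ) : ℚ_[2] ⊗[ℚ] K) *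
        ((a : ℚ_[2]) ^ 2 - D * (b : ℚ_[2]) ^ 2) = 1 := by
      rw [← hnu, ← map_mul, Units.inv_mul, map_one]
    obtain ⟨x, y, hxy⟩ := h.exists_repr_padic (z * (u⁻¹ : (ℚ_[2] ⊗[ℚ] K)ˣ))
    refine Padic.sq_sub_mul_sq_ne hD hm3 x y ?_
    rw [← h.norm_padic, ← hxy, map_mul, hz]
    push_cast
    linear_combination (m : ℚ_[2]) * hinv

end IsImaginaryQuadratic

/-! ### Determinants against products of ideals, and equality of ideal classes. -/

/-- Each Leibniz term lies in the product of the `C (π i)`, which is the product of the `C i`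
reordered. This bounds both the change of Steinitz ideals under a change of basis and the volume in
terms of the scale. -/
theorem Submodule.prod_mul_prod_mul_span_det_le {R S ι : Type*} [CommRing R] [CommRing S]
    [Algebra R S] [Fintype ι] [DecidableEq ι] (A B C : ι → Submodule R S) (H : Matrix ι ι S)
    (h : ∀ i j, A i * B j * Submodule.span R {H i j} ≤ C i) :
    (∏ i, A i) * (∏ i, B i) * Submodule.span R {H.det} ≤ ∏ i, C i := by
  have hπ : ∀ π : Equiv.Perm ι, (∏ i, A i) * (∏ i, B i) * Submodule.span R {∏ i, H (π i) i} ≤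
      ∏ i, C i := by
    intro π
    rw [← Submodule.prod_span_singleton, ← Equiv.prod_comp π A, ← Finset.prod_mul_distrib,
      ← Finset.prod_mul_distrib, ← Equiv.prod_comp π C]
    exact Finset.prod_le_prod' fun i _ => h _ _
  rw [Submodule.mul_le]
  intro c hc d hd
  obtain ⟨r, rfl⟩ := Submodule.mem_span_singleton.1 hd
  rw [mul_smul_comm, Matrix.det_apply, Finset.mul_sum]
  refine Submodule.smul_mem _ _ (Submodule.sum_mem _ fun π _ => ?_)
  rw [mul_smul_comm]
  have := hπ π (Submodule.mul_mem_mul hc (Submodule.mem_span_singleton_self _))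
  rcases Int.units_eq_one_or (Equiv.Perm.sign π) with hs | hs <;> rw [hs]
  · simpa using this
  · simpa using this

theorem ClassGroup.mk_eq_mk_iff_exists {R K : Type*} [CommRing R] [IsDomain R] [Field K]
    [Algebra R K] [IsFractionRing R K] {I J : (FractionalIdeal R⁰ K)ˣ} :
    ClassGroup.mk K I = ClassGroup.mk K J ↔ ∃ γ : Kˣ, I = toPrincipalIdeal R K γ * J := by
  rw [← div_eq_one, ← map_div, ClassGroup.mk_eq_one_iff]
  constructor
  · intro hp
    obtain ⟨x, hx⟩ := hp.principal
    have : I / J ∈ (toPrincipalIdeal R K).range := by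
      rw [mem_principal_ideals_iff]
      refine ⟨x, ?_⟩
      apply FractionalIdeal.coeToSubmodule_injective
      simpa using hx.symm
    obtain ⟨γ, hγ⟩ := this
    exact ⟨γ, by rw [hγ, div_mul_cancel]⟩
  · rintro ⟨γ, rfl⟩
    rw [mul_div_cancel_right]
    refine ⟨⟨(γ : K), ?_⟩⟩
    simp

/-! ### Positivity of determinants of definite hermitian matrices. -/

namespace IsImaginaryQuadratic

variable {K : Type u} [Field K] [NumberField K] {D : ℤ} {δ : K} {σ : K ≃ₐ[ℚ] K}

/-- The determinant of a positive definite hermitian matrix is positive. -/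
theorem det_pos_of_posDef (h : IsImaginaryQuadratic D δ σ) : ∀ (n : ℕ) (H : Matrix (Fin n) (Fin n) K)
    (_ : ∀ i j, σ (H i j) = H j i)
    (_ : ∀ v : Fin n → K, v ≠ 0 →
      ∃ q : ℚ, 0 < q ∧ ∑ i, ∑ j, v i * σ (v j) * H i j = q),
    ∃ q : ℚ, 0 < q ∧ H.det = q
  | 0, H, _, _ => ⟨1, one_pos, by simp⟩
  | n + 1, H, herm, hpos => by
    obtain ⟨a, ha, haH⟩ : ∃ a : ℚ, 0 < a ∧ H 0 0 = a := by
      obtain ⟨q, hq, hqe⟩ := hpos (Pi.single 0 1) (by simp)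
      refine ⟨q, hq, ?_⟩
      rw [← hqe, Finset.sum_eq_single 0 (fun i _ hi => by simp [hi]) (by simp),
        Finset.sum_eq_single 0 (fun j _ hj => by simp [hj]) (by simp)]
      simp
    have ha0 : (a : K) ≠ 0 := by exact_mod_cast ha.ne'
    let e : Fin 1 ⊕ Fin n ≃ Fin (n + 1) := finSumFinEquiv.trans (finCongr (add_comm 1 n))
    have he0 : ∀ i, e (Sum.inl i) = 0 := fun i => by ext; simp [e]
    have he1 : ∀ i, e (Sum.inr i) = i.succ := fun i => by ext; simp [e]
    let S : Matrix (Fin n) (Fin n) K := fun i j =>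
      a * H i.succ j.succ - H i.succ 0 * H 0 j.succ
    have hdet : (a : K) ^ n * H.det = a * S.det := by
      have := Matrix.det_pow_mul_det_fromBlocks (H.submatrix e e).toBlocks₁₁
        (H.submatrix e e).toBlocks₁₂ (H.submatrix e e).toBlocks₂₁ (H.submatrix e e).toBlocks₂₂
      rw [Matrix.fromBlocks_toBlocks, Matrix.det_submatrix_equiv_self, Fintype.card_fin] at this
      have hA : (H.submatrix e e).toBlocks₁₁.det = a := by
        rw [Matrix.det_fin_one]
        simp [Matrix.toBlocks₁₁, he0, haH]
      rw [hA] at this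
      rw [this]
      congr 2
      ext i j
      simp [Matrix.toBlocks₂₂, Matrix.toBlocks₂₁, Matrix.toBlocks₁₂, he0, he1, S, Matrix.mul_apply]
    obtain ⟨s, hs, hsS⟩ := det_pos_of_posDef h n S (by
      intro i j
      simp only [S, map_sub, map_mul, herm, map_ratCast]
      ring) (by
      intro y hy
      obtain ⟨i₀, hi₀⟩ := Function.ne_iff.1 hy
      set c := ∑ i, y i * H i.succ 0 with hc
      have hσc : σ c = ∑ j, σ (y j) * H 0 j.succ := by
        rw [hc, map_sum]
        simp [herm]
      -- The vector (-c, ay) is the multiple of (0, y) projected orthogonally to the first basis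
      -- vector, cleared of the denominator a. The form takes on it a times the value of S at y, so
      -- S inherits positivity.
      obtain ⟨q, hq, hqe⟩ := hpos (Fin.cons (-c) fun i => a * y i) (fun hv => by
        have := congrFun hv i₀.succ
        simp only [Fin.cons_succ, Pi.zero_apply, mul_eq_zero, ha0, false_or] at this
        exact hi₀ this)
      refine ⟨q / a, div_pos hq ha, ?_⟩
      push_cast
      rw [eq_div_iff ha0, ← hqe]
      simp only [Fin.sum_univ_succ, Fin.cons_zero, Fin.cons_succ, map_neg, map_mul, map_ratCast,
        Finset.sum_add_distrib]
      have t1 : ∑ j, -c * (a * σ (y j)) * H 0 j.succ = -(a * c * σ c) := by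
        rw [hσc, ← neg_mul, Finset.mul_sum]
        exact Finset.sum_congr rfl fun j _ => by ring
      have t2 : ∑ i, a * y i * -σ c * H i.succ 0 = -(a * c * σ c) := by
        conv_rhs => rw [hc]
        rw [Finset.mul_sum, Finset.sum_mul, ← Finset.sum_neg_distrib]
        exact Finset.sum_congr rfl fun j _ => by ring
      have t3 : ∑ i, ∑ j, a * y i * (a * σ (y j)) * H i.succ j.succ =
          a * (∑ i, ∑ j, y i * σ (y j) * S i j) + a * (c * σ c) := by
        have t4 : c * σ c = ∑ i, ∑ j, y i * H i.succ 0 * (σ (y j) * H 0 j.succ) := by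
          rw [hσc, hc, Finset.sum_mul_sum]
        rw [t4, ← mul_add, ← Finset.sum_add_distrib, Finset.mul_sum]
        refine Finset.sum_congr rfl fun i _ => ?_
        rw [← Finset.sum_add_distrib, Finset.mul_sum]
        refine Finset.sum_congr rfl fun j _ => ?_
        simp only [S]
        ring
      rw [t1, t2, t3, haH]
      ring)
    refine ⟨a * s / a ^ n, by positivity, ?_⟩
    push_cast
    rw [eq_div_iff (pow_ne_zero _ ha0), ← hsS, ← hdet, mul_comm]

end IsImaginaryQuadratic

/-! ### Volume and Steinitz class computed from a pseudo-basis. -/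

namespace HermitianLattice

variable {K : Type u} [Field K] [NumberField K] {D : ℤ} {δ : K} {σ : K ≃ₐ[ℚ] K}
  {V : HermitianSpace K σ} {L : HermitianLattice V} {n : ℕ}

/-- The Gram matrix of the basis of a pseudo-basis. -/
noncomputable def PseudoBasis.gram (P : L.PseudoBasis n) : Matrix (Fin n) (Fin n) K :=
  Matrix.of fun i j => V.form (P.basis i) (P.basis j)

/-- Each product 𝔞ᵢσ(𝔞ᵢ) is generated by N(𝔞ᵢ), so the volume is principal with an explicit
generator. -/
theorem PseudoBasis.volume_eq (h : IsImaginaryQuadratic D δ σ) (P : L.PseudoBasis n) :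
    P.volume = Submodule.span (𝓞 K)
      {((∏ i, FractionalIdeal.absNorm (P.ideal i : FractionalIdeal (𝓞 K)⁰ K) : ℚ) : K) *
        P.gram.det} := by
  rw [PseudoBasis.volume, Finset.prod_congr rfl fun i _ => h.mul_span_conj (P.ideal i : _),
    Submodule.prod_span_singleton, Submodule.span_mul_span, Set.singleton_mul_singleton]
  push_cast
  rfl

theorem PseudoBasis.smul_mem (P : L.PseudoBasis n) {i : Fin n} {a : K}
    (ha : a ∈ (P.ideal i : FractionalIdeal (𝓞 K)⁰ K)) : a • P.basis i ∈ L.toSubmodule := by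
  rw [P.mem_iff]
  intro j
  rw [map_smul, Basis.repr_self, Finsupp.smul_single, smul_eq_mul, mul_one]
  by_cases hij : i = j
  · subst hij; simpa using ha
  · rw [Finsupp.single_eq_of_ne (Ne.symm hij)]
    exact FractionalIdeal.zero_mem _

/-- The j-th ideal of `Q` times the (i,j) entry of the transition matrix lies in the i-th ideal of
`P`, so the Leibniz bound applies. The same bound with `P` and `Q` exchanged gives the reverse
inclusion, because the two determinants are inverse. -/
theorem PseudoBasis.prod_mul_span_det_le (P Q : L.PseudoBasis n) :
    ((∏ i, (Q.ideal i : FractionalIdeal (𝓞 K)⁰ K) : FractionalIdeal (𝓞 K)⁰ K) :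
        Submodule (𝓞 K) K) * Submodule.span (𝓞 K) {(P.basis.toMatrix Q.basis).det} ≤
      ((∏ i, (P.ideal i : FractionalIdeal (𝓞 K)⁰ K) : FractionalIdeal (𝓞 K)⁰ K) :
        Submodule (𝓞 K) K) := by
  have := Submodule.prod_mul_prod_mul_span_det_le (R := 𝓞 K) (fun _ : Fin n => 1)
    (fun i => ((Q.ideal i : FractionalIdeal (𝓞 K)⁰ K) : Submodule (𝓞 K) K))
    (fun i => ((P.ideal i : FractionalIdeal (𝓞 K)⁰ K) : Submodule (𝓞 K) K))
    (P.basis.toMatrix Q.basis) (by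
      intro i j
      rw [one_mul, Submodule.mul_le]
      intro b hb d hd
      obtain ⟨r, rfl⟩ := Submodule.mem_span_singleton.1 hd
      rw [mul_smul_comm]
      refine Submodule.smul_mem _ _ ?_
      have := (P.mem_iff _).1 (Q.smul_mem hb) i
      simpa [Basis.toMatrix_apply] using this)
  rw [Finset.prod_const_one, one_mul] at this
  simpa only [← FractionalIdeal.coeSubmoduleHom_apply, map_prod] using this

/-- The Steinitz class does not depend on the pseudo-basis. -/
theorem PseudoBasis.mk_prod_eq (P Q : L.PseudoBasis n) :
    ClassGroup.mk K (∏ i, P.ideal i) = ClassGroup.mk K (∏ i, Q.ideal i) := by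
  have hdet : (P.basis.toMatrix Q.basis).det * (Q.basis.toMatrix P.basis).det = 1 := by
    rw [← Matrix.det_mul, Basis.toMatrix_mul_toMatrix_flip, Matrix.det_one]
  rw [ClassGroup.mk_eq_mk_iff_exists]
  refine ⟨Units.mk0 _ (left_ne_zero_of_mul_eq_one hdet), ?_⟩
  apply Units.ext
  apply FractionalIdeal.coeToSubmodule_injective
  have h1 := P.prod_mul_span_det_le Q
  have h2 := Q.prod_mul_span_det_le P
  simp only [Units.val_mul, coe_toPrincipalIdeal, Units.val_mk0, Units.coe_prod,
    FractionalIdeal.coe_mul, FractionalIdeal.coe_spanSingleton]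
  apply le_antisymm
  · have h3 := mul_le_mul' h2 (le_refl (Submodule.span (𝓞 K)
      {(P.basis.toMatrix Q.basis).det}))
    rw [mul_assoc, Submodule.span_mul_span, Set.singleton_mul_singleton, mul_comm (Matrix.det _),
      hdet, ← Submodule.one_eq_span, mul_one] at h3
    rwa [mul_comm]
  · rwa [mul_comm]

end HermitianLattice

/-! ### Necessity: what an even unimodular lattice imposes on `D`, the rank and the Steinitz class.
-/

namespace IsImaginaryQuadratic

variable {K : Type u} [Field K] [NumberField K] {D : ℤ} {δ : K} {σ : K ≃ₐ[ℚ] K}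

/-- The embedding of `ℤ√D` into `K`. -/
noncomputable def ofZsqrtd (h : IsImaginaryQuadratic D δ σ) : ℤ√D →+* K :=
  Zsqrtd.lift ⟨δ, by rw [← pow_two, h.sq]⟩

theorem ofZsqrtd_apply (h : IsImaginaryQuadratic D δ σ) (z : ℤ√D) :
    h.ofZsqrtd z = z.re + z.im * δ := rfl

theorem ofZsqrtd_injective (h : IsImaginaryQuadratic D δ σ) : Function.Injective h.ofZsqrtd :=
  Zsqrtd.lift_injective _ fun n hn => by
    have := h.neg
    nlinarith [mul_self_nonneg n]

theorem ofZsqrtd_star (h : IsImaginaryQuadratic D δ σ) (z : ℤ√D) :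
    h.ofZsqrtd (star z) = σ (h.ofZsqrtd z) := by
  simp [ofZsqrtd_apply, h.conj]

theorem exists_ofZsqrtd_eq (h : IsImaginaryQuadratic D δ σ) (hD : ¬ D ≡ 1 [ZMOD 4]) {x : K}
    (hx : IsIntegral ℤ x) : ∃ z, h.ofZsqrtd z = x := by
  obtain ⟨a, b, rfl⟩ := h.exists_int_repr hD hx
  exact ⟨⟨a, b⟩, rfl⟩

/-- An integer in `2 𝓞 K` fixed by conjugation is an even rational integer. -/
theorem exists_int_of_mem_span_two (h : IsImaginaryQuadratic D δ σ) {x : K}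
    (hx : x ∈ Submodule.span (𝓞 K) {(2 : K)}) (hσ : σ x = x) : ∃ c : ℤ, x = ((2 * c : ℤ) : K) := by
  obtain ⟨c, rfl⟩ := Submodule.mem_span_singleton.1 hx
  obtain ⟨q, hq⟩ := h.exists_ratCast_of_conj_eq hσ
  rw [Algebra.smul_def] at hq ⊢
  have hc : (algebraMap (𝓞 K) K c) = ((q / 2 : ℚ) : K) := by
    push_cast
    rw [← hq]
    ring
  obtain ⟨m, hm⟩ := exists_intCast_of_isIntegral (hc ▸ c.isIntegral_coe)
  refine ⟨m, ?_⟩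
  rw [hc, hm]
  push_cast
  ring

/-- A positive rational number that generates the unit ideal is `1`. -/
theorem eq_one_of_span_eq_one {r : ℚ} (hr : 0 < r)
    (h1 : Submodule.span (𝓞 K) {(r : K)} = 1) : r = 1 := by
  have hmem : (r : K) ∈ (1 : Submodule (𝓞 K) K) := h1 ▸ Submodule.mem_span_singleton_self _
  obtain ⟨c, hc⟩ := Submodule.mem_one.1 hmem
  obtain ⟨a, ha⟩ := exists_intCast_of_isIntegral (hc ▸ c.isIntegral_coe)
  have h1mem : (1 : K) ∈ Submodule.span (𝓞 K) {(r : K)} := by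
    rw [h1]; exact Submodule.mem_one.2 ⟨1, map_one _⟩
  obtain ⟨d, hd⟩ := Submodule.mem_span_singleton.1 h1mem
  have hr0 : (r : K) ≠ 0 := by exact_mod_cast hr.ne'
  have hd' : (algebraMap (𝓞 K) K d) = ((r⁻¹ : ℚ) : K) := by
    rw [Algebra.smul_def] at hd
    push_cast
    exact eq_inv_of_mul_eq_one_left hd
  obtain ⟨b, hb⟩ := exists_intCast_of_isIntegral (hd' ▸ d.isIntegral_coe)
  have hab : a * b = 1 := by
    have : (a : ℚ) * b = 1 := by rw [← ha, ← hb, mul_inv_cancel₀ hr.ne']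
    exact_mod_cast this
  have ha0 : 0 < a := by
    have : (0 : ℚ) < a := ha ▸ hr
    exact_mod_cast this
  rw [ha, Int.eq_one_or_neg_one_of_mul_eq_one hab |>.resolve_right (by omega)]
  simp

end IsImaginaryQuadratic

namespace HermitianLattice

variable {K : Type u} [Field K] [NumberField K] {D : ℤ} {δ : K} {σ : K ≃ₐ[ℚ] K}
  {V : HermitianSpace K σ} {L : HermitianLattice V} {n : ℕ}

theorem form_smul_smul (a b : K) (x y : V.carrier) :
    V.form (a • x) (b • y) = a * σ b * V.form x y := by
  simp [mul_assoc, mul_left_comm]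

theorem form_mem_scale {x y : V.carrier} (hx : x ∈ L.toSubmodule) (hy : y ∈ L.toSubmodule) :
    V.form x y ∈ L.scale :=
  Submodule.subset_span ⟨x, hx, y, hy, rfl⟩

theorem form_mem_span_two (hev : L.IsEven) {x : V.carrier} (hx : x ∈ L.toSubmodule) :
    V.form x x ∈ Submodule.span (𝓞 K) {(2 : K)} :=
  hev (Submodule.subset_span ⟨x, hx, rfl⟩)

/-- An integral lattice of volume `𝓞 K` has scale `𝓞 K`. -/
theorem scale_eq_one_of_volume (hn : 1 ≤ n) (P : L.PseudoBasis n)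
    (hint : ∀ x ∈ L.toSubmodule, ∀ y ∈ L.toSubmodule, V.form x y ∈ (1 : Submodule (𝓞 K) K))
    (hvol : P.volume = 1) : L.scale = 1 := by
  have hle : L.scale ≤ 1 := by
    rw [scale, Submodule.span_le]
    rintro _ ⟨x, hx, y, hy, rfl⟩
    exact hint x hx y hy
  refine le_antisymm hle ?_
  rw [← hvol, PseudoBasis.volume, Finset.prod_mul_distrib]
  -- The volume lies in the n-th power of the scale, and for n ≥ 1 this power lies in the scale,
  -- which is integral. So the scale contains 𝓞.
  refine (Submodule.prod_mul_prod_mul_span_det_le _ _ (fun _ => L.scale) _ ?_).trans ?_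
  · intro i j
    rw [← Submodule.span_eq ((P.ideal i : FractionalIdeal (𝓞 K)⁰ K) : Submodule (𝓞 K) K),
      Submodule.span_mul_span, Submodule.span_mul_span, Submodule.span_le]
    rintro _ ⟨_, ⟨a, ha, _, ⟨b, hb, rfl⟩, rfl⟩, _, rfl, rfl⟩
    have := form_mem_scale (P.smul_mem ha) (P.smul_mem hb)
    rw [form_smul_smul] at this
    exact this
  · rw [Finset.prod_const, Finset.card_univ, Fintype.card_fin]
    obtain ⟨k, rfl⟩ := Nat.exists_eq_add_of_le' hn
    rw [pow_succ]
    exact (mul_le_mul' (pow_le_one' hle k) le_rfl).trans_eq (one_mul _)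

/-- Polarisation puts the trace of c·h(x,y) in 2𝓞 for every integer c, hence the trace of every
element of the scale. As the scale is 𝓞, this contradicts that (1+δ)/2 has trace 1. -/
theorem not_modEq_one_of_isEven (h : IsImaginaryQuadratic D δ σ) (hev : L.IsEven)
    (hscale : L.scale = 1) : ¬ D ≡ 1 [ZMOD 4] := by
  intro hD
  have key : ∀ z ∈ L.scale, ∀ c : 𝓞 K,
      (c : K) * z + σ (c * z) ∈ Submodule.span (𝓞 K) {(2 : K)} := by
    intro z hz
    induction hz using Submodule.span_induction with
    | mem z hz =>
      obtain ⟨x, hx, y, hy, rfl⟩ := hz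
      intro c
      have hcx : c • x ∈ L.toSubmodule := L.toSubmodule.smul_mem c hx
      have e : (c : K) * V.form x y + σ (c * V.form x y) =
          V.form (c • x + y) (c • x + y) - V.form (c • x) (c • x) - V.form y y := by
        have e1 : (c : K) * V.form x y = V.form (c • x) y := by
          rw [← IsScalarTower.algebraMap_smul K c x, map_smul, LinearMap.smul_apply, smul_eq_mul]
        rw [e1, ← V.form_conj, map_add V.form, LinearMap.add_apply, map_add, map_add]
        ring
      rw [e]
      exact sub_mem (sub_mem (form_mem_span_two hev (add_mem hcx hy)) (form_mem_span_two hev hcx))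
        (form_mem_span_two hev hy)
    | zero => intro c; simp
    | add x y _ _ hx hy =>
      intro c
      rw [mul_add, map_add, add_add_add_comm]
      exact add_mem (hx c) (hy c)
    | smul d x _ hx =>
      intro c
      have := hx (c * d)
      rw [Algebra.smul_def, ← mul_assoc]
      simpa using this
  have h1 : (1 : K) ∈ L.scale := by rw [hscale]; exact Submodule.mem_one.2 ⟨1, map_one _⟩
  obtain ⟨ω, hω⟩ : ∃ ω : 𝓞 K, (ω : K) = (1 + δ) / 2 :=
    ⟨⟨(1 + δ) / 2, h.isIntegral_one_add_div_two hD⟩, rfl⟩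
  have h2 := key 1 h1 ω
  have e : (ω : K) * 1 + σ (ω * 1) = 1 := by
    have e2 : σ (2 : K) = 2 := map_ofNat σ 2
    rw [hω, mul_one, map_div₀, map_add, map_one, h.conj, e2]
    ring
  rw [e] at h2
  obtain ⟨c, hc⟩ := h.exists_int_of_mem_span_two h2 (map_one σ)
  have : (1 : ℤ) = 2 * c := by exact_mod_cast hc
  omega

theorem PseudoBasis.gram_conj (P : L.PseudoBasis n) (i j : Fin n) :
    σ (P.gram i j) = P.gram j i := (V.form_conj _ _).symm

theorem PseudoBasis.exists_det_gram_eq (h : IsImaginaryQuadratic D δ σ) (hon : L.IsOn)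
    (hdef : L.IsDefinite) (P : L.PseudoBasis n) : ∃ q : ℚ, 0 < q ∧ P.gram.det = q := by
  refine h.det_pos_of_posDef n P.gram P.gram_conj fun v hv => ?_
  obtain ⟨q, hq, hqe⟩ := hdef (∑ i, v i • P.basis i) (by rw [hon]; trivial) (fun h0 => hv (by
    ext i
    exact Fintype.linearIndependent_iff.1 P.basis.linearIndependent v h0 i))
  refine ⟨q, hq, ?_⟩
  rw [eq_ratCast] at hqe
  rw [← hqe, map_sum V.form, LinearMap.sum_apply]
  refine Finset.sum_congr rfl fun i _ => ?_
  rw [map_sum]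
  refine Finset.sum_congr rfl fun j _ => ?_
  rw [form_smul_smul]
  rfl

/-- A definite lattice of volume `𝓞 K` satisfies `∏ N(𝔞ᵢ) · det = 1`. -/
theorem PseudoBasis.prod_absNorm_mul_det (h : IsImaginaryQuadratic D δ σ) (hon : L.IsOn)
    (hdef : L.IsDefinite) (P : L.PseudoBasis n) (hvol : P.volume = 1) :
    ((∏ i, FractionalIdeal.absNorm (P.ideal i : FractionalIdeal (𝓞 K)⁰ K) : ℚ) : K) *
      P.gram.det = 1 := by
  obtain ⟨q, hq, hqe⟩ := P.exists_det_gram_eq h hon hdef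
  rw [P.volume_eq h, hqe] at hvol
  rw [hqe]
  have hpos : 0 < ∏ i, FractionalIdeal.absNorm (P.ideal i : FractionalIdeal (𝓞 K)⁰ K) :=
    Finset.prod_pos fun i _ => IsImaginaryQuadratic.absNorm_pos _
  -- Definiteness enters here: a positive rational generator of 𝓞 is the number 1, whereas without
  -- positivity the sign would be lost.
  have := IsImaginaryQuadratic.eq_one_of_span_eq_one (K := K) (mul_pos hpos hq)
    (by rw [← hvol]; push_cast; rfl)
  exact_mod_cast this

/-- Elements aᵢ ∈ 𝔞ᵢ with norms mᵢN(𝔞ᵢ), mᵢ odd, replace `L` by a free sublattice whose Gram matrix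
lives over `ℤ√D`. Its determinant is M = ∏mᵢ since ∏N(𝔞ᵢ)·det = 1, and the matrix result gives the
parity of n and M modulo 4. The element α is ∏aᵢ. -/
theorem exists_odd_prod (h : IsImaginaryQuadratic D δ σ) (hev : L.IsEven) (hon : L.IsOn)
    (hscale : L.scale = 1) (hdef : L.IsDefinite) (P : L.PseudoBasis n) (hvol : P.volume = 1) :
    Even n ∧ ∃ (M : ℤ) (α : K), Odd M ∧ α ≠ 0 ∧ (D ≡ 3 [ZMOD 4] → M ≡ (-1) ^ (n / 2) [ZMOD 4]) ∧
      Algebra.norm ℚ α =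
        M * ∏ i, FractionalIdeal.absNorm (P.ideal i : FractionalIdeal (𝓞 K)⁰ K) := by
  have hD := not_modEq_one_of_isEven h hev hscale
  choose a ha m hm hN using fun i => h.exists_odd_norm (P.ideal i)
  have hmem : ∀ i, a i • P.basis i ∈ L.toSubmodule := fun i => P.smul_mem (ha i)
  have hG : ∀ i j, ∃ z, h.ofZsqrtd z = V.form (a i • P.basis i) (a j • P.basis j) := by
    intro i j
    refine h.exists_ofZsqrtd_eq hD ?_
    have := form_mem_scale (hmem i) (hmem j)
    rw [hscale] at this
    obtain ⟨c, hc⟩ := Submodule.mem_one.1 this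
    exact hc ▸ c.isIntegral_coe
  choose G hG using hG
  have hGe : Zsqrtd.IsEvenHermitian (Matrix.of G) := by
    constructor
    · intro i j
      apply h.ofZsqrtd_injective
      rw [h.ofZsqrtd_star, Matrix.of_apply, Matrix.of_apply, hG, hG, ← V.form_conj]
    · intro i
      obtain ⟨c, hc⟩ := h.exists_int_of_mem_span_two (form_mem_span_two hev (hmem i))
        (V.form_conj _ _).symm
      refine ⟨c, h.ofZsqrtd_injective ?_⟩
      rw [Matrix.of_apply, hG, hc, map_intCast]
  have hdetK : (∏ i, a i) * ((∏ i, σ (a i)) * P.gram.det) = ((∏ i, m i : ℤ) : K) := by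
    have e1 : ∀ i, a i * σ (a i) =
        ((m i * FractionalIdeal.absNorm (P.ideal i : FractionalIdeal (𝓞 K)⁰ K) : ℚ) : K) := by
      intro i
      rw [h.mul_conj, hN]
    rw [← mul_assoc, ← Finset.prod_mul_distrib, Finset.prod_congr rfl fun i _ => e1 i]
    push_cast
    rw [Finset.prod_mul_distrib, mul_assoc]
    have := P.prod_absNorm_mul_det h hon hdef hvol
    push_cast at this
    rw [this, mul_one]
  have hdet : (Matrix.of G).det = ((∏ i, m i : ℤ) : ℤ√D) := by
    apply h.ofZsqrtd_injective
    rw [map_intCast, ← hdetK, RingHom.map_det, ← Matrix.det_mul_row, ← Matrix.det_mul_column]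
    congr 1
    ext i j
    simp only [RingHom.mapMatrix_apply, Matrix.map_apply, Matrix.of_apply, hG, form_smul_smul]
    rw [mul_assoc]
    rfl
  have hodd : Odd (∏ i, m i) := Finset.prod_induction _ _ (fun _ _ => Odd.mul) odd_one fun i _ => hm i
  obtain ⟨hn, hmod⟩ := hGe.even_and_det_modEq n hdet hodd
  refine ⟨hn, ∏ i, m i, ∏ i, a i, hodd, ?_, hmod, ?_⟩
  · rw [Finset.prod_ne_zero_iff]
    intro i _ h0
    have := hN i
    rw [h0, Algebra.norm_zero] at this
    have h1 := (IsImaginaryQuadratic.absNorm_pos (P.ideal i)).ne'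
    have h2 : ((m i : ℤ) : ℚ) ≠ 0 := by
      have : m i ≠ 0 := by
        intro h3
        have := hm i
        rw [h3] at this
        simp at this
      exact_mod_cast this
    exact mul_ne_zero h2 h1 this.symm
  · rw [map_prod, Finset.prod_congr rfl fun i _ => hN i, Finset.prod_mul_distrib]
    push_cast
    rfl

/-- The volume and the Steinitz class are each witnessed by a pseudo-basis of unspecified length.
This identifies the lengths. -/
theorem PseudoBasis.eq_rank (hon : L.IsOn) {k : ℕ} (P : L.PseudoBasis k) : k = L.rank := by
  have e1 : L.rank = finrank K V.carrier := by
    rw [rank, hon, finrank_top]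
  rw [e1, finrank_eq_card_basis P.basis, Fintype.card_fin]

/-- The invariants of a definite even unimodular lattice. -/
theorem conditions_of_isEven (h : IsImaginaryQuadratic D δ σ) (hdef : L.IsDefinite)
    (hev : L.IsEven) (huni : L.IsUnimodular) (hrank : L.rank = n)
    {𝔞 : (FractionalIdeal (𝓞 K)⁰ K)ˣ} (hst : L.HasSteinitzClass (ClassGroup.mk K 𝔞)) :
    ¬ D ≡ 1 [ZMOD 4] ∧ Even n ∧ (D ≡ 3 [ZMOD 4] →
      normResidueSymbol K 2
        ((FractionalIdeal.absNorm (𝔞 : FractionalIdeal (𝓞 K)⁰ K) : ℚ) : ℚ_[2]) =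
          (-1) ^ (n / 2)) := by
  obtain ⟨hon, hscale, k, P, hvol⟩ := huni
  obtain ⟨l, Q, hQ⟩ := hst
  obtain rfl : k = n := (P.eq_rank hon).trans hrank
  obtain rfl : l = k := (Q.eq_rank hon).trans hrank
  rw [Q.mk_prod_eq P, ClassGroup.mk_eq_mk_iff_exists] at hQ
  obtain ⟨γ, hγ⟩ := hQ
  obtain ⟨hn, M, α, hM, hα, hmod, hN⟩ := exists_odd_prod h hev hon hscale hdef P hvol
  refine ⟨not_modEq_one_of_isEven h hev hscale, hn, fun hD => ?_⟩
  have hγN := h.norm_pos γ.ne_zero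
  have h1 : ∏ i, FractionalIdeal.absNorm (P.ideal i : FractionalIdeal (𝓞 K)⁰ K) =
      Algebra.norm ℚ (γ : K) * FractionalIdeal.absNorm (𝔞 : FractionalIdeal (𝓞 K)⁰ K) := by
    rw [← map_prod, ← Units.coe_prod, hγ, Units.val_mul, map_mul, coe_toPrincipalIdeal,
      FractionalIdeal.absNorm_span_singleton, abs_of_pos hγN]
  have hM0 : (M : ℚ) ≠ 0 := by
    have : M ≠ 0 := by rintro rfl; simp at hM
    exact_mod_cast this
  have hM0' : (M : K) ≠ 0 := by exact_mod_cast hM0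
  -- From N(α) = M·N(γ)·N(𝔞). Since M² is the norm of M, dividing by M amounts to multiplying by M
  -- up to a norm.
  have h2 : FractionalIdeal.absNorm (𝔞 : FractionalIdeal (𝓞 K)⁰ K) =
      M * Algebra.norm ℚ (α / (M * γ)) := by
    have hNM : Algebra.norm ℚ (M : K) = M ^ 2 := by
      have := h.norm_eq M 0
      simpa using this
    rw [div_eq_mul_inv, map_mul, Algebra.norm_inv, map_mul, hNM, hN, h1]
    field_simp
  rw [h2, h.normResidueSymbol_two hD hM (div_ne_zero hα (mul_ne_zero hM0' γ.ne_zero))]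
  have hmod' := hmod hD
  rcases Nat.even_or_odd (l / 2) with he | ho
  · rw [he.neg_one_pow] at hmod' ⊢
    rw [if_pos hmod']
  · rw [ho.neg_one_pow] at hmod' ⊢
    rw [if_neg]
    intro h3
    have := h3.symm.trans hmod'
    simp [Int.ModEq] at this

end HermitianLattice

/-! ### Lattices with a prescribed pseudo-basis, and criteria for even and unimodular. -/

namespace HermitianLattice

variable {K : Type u} [Field K] [NumberField K] {D : ℤ} {δ : K} {σ : K ≃ₐ[ℚ] K}
  {V : HermitianSpace K σ} {L : HermitianLattice V} {n : ℕ}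

/-- The lattice `𝔞₁x₁ + ⋯ + 𝔞ₙxₙ`. -/
noncomputable def ofBasis (b : Basis (Fin n) K V.carrier)
    (I : Fin n → (FractionalIdeal (𝓞 K)⁰ K)ˣ) : HermitianLattice V where
  toSubmodule := (Submodule.pi Set.univ fun i =>
    ((I i : FractionalIdeal (𝓞 K)⁰ K) : Submodule (𝓞 K) K)).map
      (b.equivFun.symm.restrictScalars (𝓞 K)).toLinearMap
  fg := Submodule.FG.map _ (Submodule.fg_pi fun i =>
    FractionalIdeal.fg_of_isUnit _ (I i).isUnit)

/-- The defining pseudo-basis of `ofBasis`. -/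
noncomputable def ofBasisPseudoBasis (b : Basis (Fin n) K V.carrier)
    (I : Fin n → (FractionalIdeal (𝓞 K)⁰ K)ˣ) : (ofBasis b I).PseudoBasis n where
  basis := b
  ideal := I
  mem_iff v := by
    constructor
    · rintro ⟨x, hx, rfl⟩ i
      have e : b.repr (b.equivFun.symm x) i = x i := by
        rw [← b.equivFun_apply, LinearEquiv.apply_symm_apply]
      exact e.symm ▸ hx i (Set.mem_univ i)
    · intro hv
      refine ⟨b.equivFun v, fun i _ => hv i, ?_⟩
      simp

theorem PseudoBasis.isOn (P : L.PseudoBasis n) : L.IsOn := by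
  rw [IsOn, eq_top_iff, ← P.basis.span_eq, Submodule.span_le]
  rintro _ ⟨i, rfl⟩
  obtain ⟨a, ha, ha0⟩ : ∃ a ∈ (P.ideal i : FractionalIdeal (𝓞 K)⁰ K), a ≠ 0 := by
    by_contra! hcon
    exact (P.ideal i).ne_zero (FractionalIdeal.eq_zero_iff.2 hcon)
  have : P.basis i = a⁻¹ • a • P.basis i := by rw [smul_smul, inv_mul_cancel₀ ha0, one_smul]
  rw [this]
  exact Submodule.smul_mem _ _ (Submodule.subset_span (P.smul_mem ha))

theorem PseudoBasis.smul_repr_mem (P : L.PseudoBasis n) {x : V.carrier} (hx : x ∈ L.toSubmodule)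
    (i : Fin n) : P.basis.repr x i • P.basis i ∈ L.toSubmodule :=
  P.smul_mem ((P.mem_iff x).1 hx i)

theorem PseudoBasis.form_mem_one (P : L.PseudoBasis n)
    (hint : ∀ i j, ∀ a ∈ (P.ideal i : FractionalIdeal (𝓞 K)⁰ K),
      ∀ b ∈ (P.ideal j : FractionalIdeal (𝓞 K)⁰ K),
        a * σ b * P.gram i j ∈ (1 : Submodule (𝓞 K) K)) :
    ∀ x ∈ L.toSubmodule, ∀ y ∈ L.toSubmodule, V.form x y ∈ (1 : Submodule (𝓞 K) K) := by
  intro x hx y hy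
  rw [← P.basis.sum_repr x, ← P.basis.sum_repr y, map_sum V.form, LinearMap.sum_apply]
  refine Submodule.sum_mem _ fun i _ => ?_
  rw [map_sum]
  refine Submodule.sum_mem _ fun j _ => ?_
  rw [form_smul_smul]
  exact hint i j _ ((P.mem_iff x).1 hx i) _ ((P.mem_iff y).1 hy j)

/-- In h(x+y, x+y) the mixed terms form the trace of the integer h(x,y), which is even for D ≢ 1
(mod 4). Hence evenness need only be tested on the summands. -/
theorem PseudoBasis.isEven (h : IsImaginaryQuadratic D δ σ) (hD : ¬ D ≡ 1 [ZMOD 4])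
    (P : L.PseudoBasis n)
    (hint : ∀ x ∈ L.toSubmodule, ∀ y ∈ L.toSubmodule, V.form x y ∈ (1 : Submodule (𝓞 K) K))
    (hdiag : ∀ i, ∀ a ∈ (P.ideal i : FractionalIdeal (𝓞 K)⁰ K),
      a * σ a * P.gram i i ∈ Submodule.span (𝓞 K) {(2 : K)}) : L.IsEven := by
  rw [IsEven, normIdeal, Submodule.span_le]
  rintro _ ⟨x, hx, rfl⟩
  have key : (∑ i, P.basis.repr x i • P.basis i) ∈ L.toSubmodule ∧
      V.form (∑ i, P.basis.repr x i • P.basis i) (∑ i, P.basis.repr x i • P.basis i) ∈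
        Submodule.span (𝓞 K) {(2 : K)} := by
    refine Finset.sum_induction _
      (fun y => y ∈ L.toSubmodule ∧ V.form y y ∈ Submodule.span (𝓞 K) {(2 : K)}) ?_ ?_ ?_
    · rintro y z ⟨hy, hy2⟩ ⟨hz, hz2⟩
      refine ⟨add_mem hy hz, ?_⟩
      obtain ⟨c, hc⟩ := Submodule.mem_one.1 (hint y hy z hz)
      obtain ⟨r, hr⟩ := h.add_conj_mem hD (hc ▸ c.isIntegral_coe)
      have hyz : V.form y z + V.form z y ∈ Submodule.span (𝓞 K) {(2 : K)} := by
        rw [V.form_conj z y, hr]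
        refine Submodule.mem_span_singleton.2 ⟨(r : 𝓞 K), ?_⟩
        rw [Algebra.smul_def, map_intCast, mul_comm]
      have e : V.form (y + z) (y + z) =
          V.form y y + (V.form y z + V.form z y) + V.form z z := by
        rw [map_add V.form, LinearMap.add_apply, map_add, map_add]
        ring
      rw [e]
      exact add_mem (add_mem hy2 hyz) hz2
    · exact ⟨zero_mem _, by simp⟩
    · intro i _
      refine ⟨P.smul_repr_mem hx i, ?_⟩
      rw [form_smul_smul]
      exact hdiag i _ ((P.mem_iff x).1 hx i)
  rw [P.basis.sum_repr] at key
  exact key.2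

theorem PseudoBasis.isUnimodular (h : IsImaginaryQuadratic D δ σ) (hn : 1 ≤ n)
    (P : L.PseudoBasis n)
    (hint : ∀ x ∈ L.toSubmodule, ∀ y ∈ L.toSubmodule, V.form x y ∈ (1 : Submodule (𝓞 K) K))
    (hdet : ((∏ i, FractionalIdeal.absNorm (P.ideal i : FractionalIdeal (𝓞 K)⁰ K) : ℚ) : K) *
      P.gram.det = 1) : L.IsUnimodular := by
  have hvol : P.volume = 1 := by rw [P.volume_eq h, hdet, Submodule.one_eq_span]
  exact ⟨P.isOn, scale_eq_one_of_volume hn P hint hvol, n, P, hvol⟩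

end HermitianLattice

/-! ### Diagonal definite spaces with bases given by matrix rows. -/

namespace IsImaginaryQuadratic

variable {K : Type u} [Field K] [NumberField K] {D : ℤ} {δ : K} {σ : K ≃ₐ[ℚ] K} {n : ℕ}

/-- The hermitian space `Kⁿ` with the form `∑ dᵢ xᵢ σ(yᵢ)`. -/
noncomputable def diagSpace (h : IsImaginaryQuadratic D δ σ) (d : Fin n → ℚ) :
    HermitianSpace K σ where
  carrier := Fin n → K
  form := LinearMap.mk₂'ₛₗ (RingHom.id K) (σ : K →+* K) (fun x y => ∑ i, d i * x i * σ (y i))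
    (fun x x' y => by simp [mul_add, add_mul, Finset.sum_add_distrib])
    (fun c x y => by
      simp only [Pi.smul_apply, smul_eq_mul, RingHom.id_apply, Finset.mul_sum]
      exact Finset.sum_congr rfl fun i _ => by ring)
    (fun x y y' => by simp [mul_add, Finset.sum_add_distrib])
    (fun c x y => by
      simp only [Pi.smul_apply, smul_eq_mul, Finset.mul_sum, map_mul]
      exact Finset.sum_congr rfl fun i _ => by simp; ring)
  form_conj x y := by
    simp only [LinearMap.mk₂'ₛₗ_apply, map_sum, map_mul, h.conj_conj, map_ratCast]
    exact Finset.sum_congr rfl fun i _ => by ring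

theorem diagSpace_form (h : IsImaginaryQuadratic D δ σ) (d : Fin n → ℚ) (x y : Fin n → K) :
    (h.diagSpace d).form x y = ∑ i, d i * x i * σ (y i) := rfl

theorem isDefinite_diagSpace (h : IsImaginaryQuadratic D δ σ) {d : Fin n → ℚ} (hd : ∀ i, 0 < d i)
    (L : HermitianLattice (h.diagSpace d)) : L.IsDefinite := by
  intro x _ hx
  change Fin n → K at x
  refine ⟨∑ i, d i * Algebra.norm ℚ (x i), ?_, ?_⟩
  · obtain ⟨i, hi⟩ := Function.ne_iff.1 hx
    refine Finset.sum_pos' (fun j _ => ?_) ⟨i, Finset.mem_univ i, mul_pos (hd i) (h.norm_pos hi)⟩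
    by_cases hj : x j = 0
    · rw [hj, Algebra.norm_zero, mul_zero]
    · exact (mul_pos (hd j) (h.norm_pos hj)).le
  · rw [h.diagSpace_form, eq_ratCast]
    push_cast
    refine Finset.sum_congr rfl fun i _ => ?_
    rw [mul_assoc, h.mul_conj]

open Classical in
/-- The basis of `Kⁿ` formed by the rows of an invertible matrix. -/
noncomputable def rowBasis (h : IsImaginaryQuadratic D δ σ) (d : Fin n → ℚ)
    (T : Matrix (Fin n) (Fin n) K) (hT : T.det ≠ 0) :
    Basis (Fin n) K (h.diagSpace d).carrier :=
  basisOfPiSpaceOfLinearIndependent (Matrix.linearIndependent_rows_of_det_ne_zero hT)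

theorem rowBasis_apply (h : IsImaginaryQuadratic D δ σ) (d : Fin n → ℚ)
    (T : Matrix (Fin n) (Fin n) K) (hT : T.det ≠ 0) (i : Fin n) :
    h.rowBasis d T hT i = T i :=
  congrFun (coe_basisOfPiSpaceOfLinearIndependent _) i

theorem gram_rowBasis (h : IsImaginaryQuadratic D δ σ) (d : Fin n → ℚ)
    (T : Matrix (Fin n) (Fin n) K) (hT : T.det ≠ 0) (I : Fin n → (FractionalIdeal (𝓞 K)⁰ K)ˣ)
    (i j : Fin n) :
    (HermitianLattice.ofBasisPseudoBasis (h.rowBasis d T hT) I).gram i j =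
      ∑ l, d l * T i l * σ (T j l) := by
  rw [← h.diagSpace_form, ← h.rowBasis_apply d T hT i, ← h.rowBasis_apply d T hT j]
  rfl

theorem det_gram_rowBasis (h : IsImaginaryQuadratic D δ σ) (d : Fin n → ℚ)
    (T : Matrix (Fin n) (Fin n) K) (hT : T.det ≠ 0) (I : Fin n → (FractionalIdeal (𝓞 K)⁰ K)ˣ) :
    (HermitianLattice.ofBasisPseudoBasis (h.rowBasis d T hT) I).gram.det =
      T.det * σ T.det * ∏ i, (d i : K) := by
  have : (HermitianLattice.ofBasisPseudoBasis (h.rowBasis d T hT) I).gram =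
      T * Matrix.diagonal (fun i => (d i : K)) * (T.map σ).transpose := by
    ext i j
    rw [h.gram_rowBasis, Matrix.mul_apply]
    simp only [Matrix.mul_diagonal, Matrix.transpose_apply, Matrix.map_apply]
    exact Finset.sum_congr rfl fun l _ => by ring
  have hσ : (T.map σ).det = σ T.det := (RingHom.map_det (σ : K →+* K) T).symm
  rw [this, Matrix.det_mul, Matrix.det_mul, Matrix.det_diagonal, Matrix.det_transpose, hσ]
  ring

end IsImaginaryQuadratic

/-! ### The odd unimodular lattices. -/

namespace IsImaginaryQuadratic

section

variable {K : Type*} [Field K]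

theorem mul_mem_one {x y : K} (hx : x ∈ (1 : Submodule (𝓞 K) K))
    (hy : y ∈ (1 : Submodule (𝓞 K) K)) : x * y ∈ (1 : Submodule (𝓞 K) K) := by
  simpa using Submodule.mul_mem_mul hx hy

theorem intCast_mem_one (m : ℤ) : (m : K) ∈ (1 : Submodule (𝓞 K) K) :=
  Submodule.mem_one.2 ⟨m, map_intCast _ _⟩

theorem coe_mem_one (c : 𝓞 K) : (c : K) ∈ (1 : Submodule (𝓞 K) K) :=
  Submodule.mem_one.2 ⟨c, rfl⟩

theorem two_mul_mem_span_two {x : K} (hx : x ∈ (1 : Submodule (𝓞 K) K)) :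
    2 * x ∈ Submodule.span (𝓞 K) {(2 : K)} := by
  obtain ⟨c, rfl⟩ := Submodule.mem_one.1 hx
  exact Submodule.mem_span_singleton.2 ⟨c, by rw [Algebra.smul_def, mul_comm]⟩

end

variable {K : Type u} [Field K] [NumberField K] {D : ℤ} {δ : K} {σ : K ≃ₐ[ℚ] K}

/-- The form `x₁σ(y₁) + ⋯ + xₖσ(yₖ) + N⁻¹ xₖ₊₁σ(yₖ₊₁)`. -/
noncomputable def diagCoeff (k : ℕ) (N : ℚ) : Fin (k + 1) → ℚ :=
  Fin.snoc (α := fun _ => ℚ) (fun _ => 1) N⁻¹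

theorem diagCoeff_pos (k : ℕ) {N : ℚ} (hN : 0 < N) (i : Fin (k + 1)) : 0 < diagCoeff k N i := by
  refine Fin.lastCases ?_ (fun i => ?_) i
  · simpa [diagCoeff] using hN
  · simp [diagCoeff]

theorem prod_diagCoeff (k : ℕ) (N : ℚ) : ∏ i, (diagCoeff k N i : K) = (N : K)⁻¹ := by
  rw [Fin.prod_univ_castSucc]
  simp [diagCoeff]

theorem gram_diagCoeff (h : IsImaginaryQuadratic D δ σ) (k : ℕ) (N : ℚ)
    (T : Matrix (Fin (k + 1)) (Fin (k + 1)) K) (hT : T.det ≠ 0)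
    (I : Fin (k + 1) → (FractionalIdeal (𝓞 K)⁰ K)ˣ) (i j : Fin (k + 1)) :
    (HermitianLattice.ofBasisPseudoBasis (h.rowBasis (diagCoeff k N) T hT) I).gram i j =
      ∑ l : Fin k, T i l.castSucc * σ (T j l.castSucc) +
        (N : K)⁻¹ * (T i (Fin.last k) * σ (T j (Fin.last k))) := by
  rw [h.gram_rowBasis, Fin.sum_univ_castSucc]
  simp [diagCoeff, mul_assoc]

theorem mem_one_unit {x : K} :
    x ∈ (((1 : (FractionalIdeal (𝓞 K)⁰ K)ˣ)) : FractionalIdeal (𝓞 K)⁰ K) ↔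
      x ∈ (1 : Submodule (𝓞 K) K) := by
  rw [Units.val_one, ← FractionalIdeal.mem_coe, FractionalIdeal.coe_one]

theorem conj_mem_one {x : K} (hx : x ∈ (1 : Submodule (𝓞 K) K)) :
    σ x ∈ (1 : Submodule (𝓞 K) K) := by
  obtain ⟨c, rfl⟩ := Submodule.mem_one.1 hx
  exact Submodule.mem_one.2 ⟨conjInt σ c, rfl⟩

/-- `x σ(y) / N(I)` is integral for `x, y ∈ I`. -/
theorem inv_absNorm_mul_mem_one (h : IsImaginaryQuadratic D δ σ) (I : (FractionalIdeal (𝓞 K)⁰ K)ˣ)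
    {x y : K} (hx : x ∈ (I : FractionalIdeal (𝓞 K)⁰ K))
    (hy : y ∈ (I : FractionalIdeal (𝓞 K)⁰ K)) :
    ((FractionalIdeal.absNorm (I : FractionalIdeal (𝓞 K)⁰ K) : ℚ) : K)⁻¹ * (x * σ y) ∈
      (1 : Submodule (𝓞 K) K) := by
  obtain ⟨c, hc⟩ := h.mul_conj_mem hx hy
  have h0 : ((FractionalIdeal.absNorm (I : FractionalIdeal (𝓞 K)⁰ K) : ℚ) : K) ≠ 0 := by
    exact_mod_cast (absNorm_pos I).ne'
  rw [hc, inv_mul_cancel_left₀ h0]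
  exact coe_mem_one c

/-- There is a definite odd unimodular lattice of each rank and Steinitz class. -/
theorem exists_odd_unimodular (h : IsImaginaryQuadratic D δ σ) (𝔞 : (FractionalIdeal (𝓞 K)⁰ K)ˣ)
    (k : ℕ) : ∃ (V : HermitianSpace K σ) (L : HermitianLattice V),
      L.IsDefinite ∧ L.IsOdd ∧ L.IsUnimodular ∧ L.rank = k + 1 ∧
        L.HasSteinitzClass (ClassGroup.mk K 𝔞) := by
  set N := FractionalIdeal.absNorm (𝔞 : FractionalIdeal (𝓞 K)⁰ K) with hN
  have hNpos : 0 < N := absNorm_pos 𝔞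
  have hN0 : (N : K) ≠ 0 := by exact_mod_cast hNpos.ne'
  -- The lattice is 𝓞 ⊥ ⋯ ⊥ 𝓞 ⊥ 𝔞. The coefficient N⁻¹ on the last coordinate compensates for the
  -- norm of 𝔞 in the volume.
  let I : Fin (k + 1) → (FractionalIdeal (𝓞 K)⁰ K)ˣ :=
    Fin.snoc (α := fun _ => (FractionalIdeal (𝓞 K)⁰ K)ˣ) (fun _ => 1) 𝔞
  have hdet1 : (1 : Matrix (Fin (k + 1)) (Fin (k + 1)) K).det ≠ 0 := by simp
  let P := HermitianLattice.ofBasisPseudoBasis (h.rowBasis (diagCoeff k N) 1 hdet1) I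
  have hPI : P.ideal = I := rfl
  have hlast : P.gram (Fin.last k) (Fin.last k) = (N : K)⁻¹ := by
    rw [h.gram_diagCoeff]
    simp [(Fin.castSucc_lt_last _).ne']
  have hint := P.form_mem_one (by
    intro i j a ha b hb
    rw [hPI] at ha hb
    rcases eq_or_ne i j with rfl | hij
    · induction i using Fin.lastCases with
      | last =>
        rw [hlast]
        simp only [I, Fin.snoc_last] at ha hb
        rw [mul_comm]
        exact h.inv_absNorm_mul_mem_one 𝔞 ha hb
      | cast i =>
        have : P.gram i.castSucc i.castSucc = 1 := by
          rw [h.gram_diagCoeff]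
          simp [Matrix.one_apply, (Fin.castSucc_lt_last _).ne]
        rw [this, mul_one]
        simp only [I, Fin.snoc_castSucc, mem_one_unit] at ha hb
        exact mul_mem_one ha (conj_mem_one hb)
    · have : P.gram i j = 0 := by
        rw [h.gram_rowBasis]
        refine Finset.sum_eq_zero fun l _ => ?_
        rcases eq_or_ne i l with rfl | hil
        · simp [Matrix.one_apply_ne (Ne.symm hij)]
        · simp [Matrix.one_apply_ne hil]
      rw [this, mul_zero]
      exact zero_mem _)
  refine ⟨_, _, h.isDefinite_diagSpace (diagCoeff_pos k hNpos) _, ?_,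
    P.isUnimodular h (by omega) hint ?_, (P.eq_rank P.isOn).symm, k + 1, P, ?_⟩
  -- The vector t times the last basis vector has value N(t)/N(𝔞) = m, which is odd.
  · intro hev
    obtain ⟨t, ht, m, hm, hNt⟩ := h.exists_odd_norm 𝔞
    have htI : t ∈ (P.ideal (Fin.last k) : FractionalIdeal (𝓞 K)⁰ K) := by
      simpa [hPI, I] using ht
    have h2 := HermitianLattice.form_mem_span_two hev (P.smul_mem htI)
    obtain ⟨c, hc⟩ := h.exists_int_of_mem_span_two h2 (HermitianSpace.form_conj _ _ _).symm
    rw [HermitianLattice.form_smul_smul] at hc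
    change t * σ t * P.gram (Fin.last k) (Fin.last k) = _ at hc
    rw [hlast, h.mul_conj, hNt] at hc
    have : m = 2 * c := by
      rw [Rat.cast_mul, mul_assoc, mul_inv_cancel₀ hN0, mul_one, Rat.cast_intCast] at hc
      exact Int.cast_injective hc
    rw [this, Int.odd_iff] at hm
    omega
  · rw [h.det_gram_rowBasis, prod_diagCoeff, Fin.prod_univ_castSucc]
    simp [hPI, I, ← hN, hN0]
  · rw [hPI, Fin.prod_univ_castSucc]
    simp [I]

/-! ### The ramified prime above 2. -/

/-- For `D ≢ 1 (mod 4)` the ramified prime above `2`. -/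
theorem exists_prime_above_two (h : IsImaginaryQuadratic D δ σ) (hD : ¬ D ≡ 1 [ZMOD 4]) :
    ∃ P : (FractionalIdeal (𝓞 K)⁰ K)ˣ,
      FractionalIdeal.absNorm (P : FractionalIdeal (𝓞 K)⁰ K) = 2 ∧
      (2 : K) ∈ (P : FractionalIdeal (𝓞 K)⁰ K) ∧
      (P : FractionalIdeal (𝓞 K)⁰ K) ≤ 1 ∧
      ∀ x ∈ (P : FractionalIdeal (𝓞 K)⁰ K), σ x ∈ (P : FractionalIdeal (𝓞 K)⁰ K) := by
  have hD4 : D % 4 = 2 ∨ D % 4 = 3 := by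
    have h4 : ¬ D % 4 = 0 := by
      intro h0
      have : (2 : ℤ) * 2 ∣ D := by simpa using Int.dvd_of_emod_eq_zero h0
      have := h.squarefree 2 this
      rw [Int.isUnit_iff] at this
      omega
    simp only [Int.ModEq] at hD
    omega
  obtain ⟨d, hd⟩ : ∃ d : 𝓞 K, (d : K) = δ := ⟨⟨δ, h.isIntegral_sqrt⟩, rfl⟩
  have hd2 : d ^ 2 = (D : 𝓞 K) := by
    ext
    simp [hd, h.sq]
  -- The prime is (2, ρ) with ρ = √D for D ≡ 2 and ρ = 1 + √D for D ≡ 3. The relation for ρ² and the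
  -- expression of 2 give (2, ρ)² = (2). The relation for the conjugate of ρ shows that the ideal is
  -- stable under conjugation.
  obtain ⟨ρ, z, u, x, y, hρ, hu, h2⟩ : ∃ (ρ : 𝓞 K) (z : ℤ) (u x y : 𝓞 K),
      conjInt σ ρ = z * 2 - ρ ∧ ρ * ρ = 2 * u ∧
        (2 : 𝓞 K) = ρ * ρ + x * (2 * ρ) + y * (2 * 2) := by
    have hσd : conjInt σ d = -d := by
      ext
      simp [hd, h.conj]
    rcases hD4 with hD4 | hD4
    · obtain ⟨j, hj⟩ : ∃ j, D = 4 * j + 2 := ⟨D / 4, by omega⟩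
      have hjK : (D : 𝓞 K) = 4 * j + 2 := by rw [hj]; push_cast; ring
      refine ⟨d, 0, 2 * j + 1, 0, -j, ?_, ?_, ?_⟩
      · rw [hσd]; simp
      · linear_combination hd2 + hjK
      · linear_combination - hd2 - hjK
    · obtain ⟨j, hj⟩ : ∃ j, D = 4 * j + 3 := ⟨D / 4, by omega⟩
      have hjK : (D : 𝓞 K) = 4 * j + 3 := by rw [hj]; push_cast; ring
      refine ⟨1 + d, 1, 2 * j + 2 + d, -1, -j, ?_, ?_, ?_⟩
      · rw [map_add, map_one, hσd]; push_cast; ring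
      · linear_combination hd2 + hjK
      · linear_combination - hd2 - hjK
  let P₀ : Ideal (𝓞 K) := Ideal.span {2, ρ}
  have hsq : P₀ * P₀ = Ideal.span {(2 : 𝓞 K)} := by
    rw [Ideal.span_pair_mul_span_pair]
    apply le_antisymm
    · rw [Ideal.span_le]
      rintro w hw
      simp only [Set.mem_insert_iff, Set.mem_singleton_iff] at hw
      rw [SetLike.mem_coe, Ideal.mem_span_singleton]
      rcases hw with rfl | rfl | rfl | rfl
      · exact Dvd.intro _ rfl
      · exact Dvd.intro _ rfl
      · exact Dvd.intro_left _ rfl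
      · exact Dvd.intro _ hu.symm
    · rw [Ideal.span_singleton_le_iff_mem]
      refine (congrArg (· ∈ _) h2).mpr ?_
      refine add_mem (add_mem ?_ (Ideal.mul_mem_left _ _ ?_)) (Ideal.mul_mem_left _ _ ?_)
      all_goals exact Ideal.subset_span (by simp)
  have hnorm : Ideal.absNorm P₀ = 2 := by
    have h3 := congrArg Ideal.absNorm hsq
    rw [map_mul, Ideal.absNorm_span_singleton] at h3
    have h4 : (Algebra.norm ℤ (2 : 𝓞 K)) = 2 ^ 2 := by
      have := Algebra.norm_algebraMap_of_basis (RingOfIntegers.basis K) (2 : ℤ)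
      rw [← finrank_eq_card_basis (RingOfIntegers.basis K), RingOfIntegers.rank,
        h.finrank_eq_two] at this
      simpa using this
    rw [h4] at h3
    norm_num at h3
    nlinarith
  have hP0 : (P₀ : FractionalIdeal (𝓞 K)⁰ K) ≠ 0 := by
    rw [ne_eq, FractionalIdeal.coeIdeal_eq_zero]
    intro h0
    rw [h0] at hnorm
    simp at hnorm
  refine ⟨Units.mk0 _ hP0, ?_, ?_, FractionalIdeal.coeIdeal_le_one, ?_⟩
  · rw [Units.val_mk0, FractionalIdeal.coeIdeal_absNorm, hnorm]
    norm_num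
  · rw [Units.val_mk0, FractionalIdeal.mem_coeIdeal]
    exact ⟨2, Ideal.subset_span (by simp), map_ofNat _ 2⟩
  · intro w hw
    rw [Units.val_mk0, FractionalIdeal.mem_coeIdeal] at hw ⊢
    obtain ⟨w, hw, rfl⟩ := hw
    obtain ⟨a, b, rfl⟩ := Ideal.mem_span_pair.1 hw
    refine ⟨conjInt σ (a * 2 + b * ρ), ?_, rfl⟩
    refine Ideal.mem_span_pair.2 ⟨conjInt σ a + conjInt σ b * z, - conjInt σ b, ?_⟩
    rw [map_add, map_mul, map_mul, hρ, map_ofNat]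
    ring

end IsImaginaryQuadratic

/-! ### The even neighbour of ⟨1⟩ ⊥ ⋯ ⊥ ⟨1⟩ ⊥ 𝔞. -/

/-- The matrix with rows `(1,…,1,t)`, `eᵢ - t eₙ` for `1 < i < n`, and `eₙ`. -/
def neighborMatrix {K : Type*} [Field K] (k : ℕ) (t : K) :
    Matrix (Fin (k + 1 + 1)) (Fin (k + 1 + 1)) K :=
  Matrix.of (Fin.snoc (α := fun _ => Fin (k + 1 + 1) → K)
    (Fin.cons (α := fun _ => Fin (k + 1 + 1) → K) (Fin.snoc (α := fun _ => K) (fun _ => 1) t)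
      (fun i : Fin k => Fin.snoc (α := fun _ => K) (Pi.single i.succ 1) (-t)))
    (Fin.snoc (α := fun _ => K) 0 1))

section neighborMatrix

variable {K : Type*} [Field K] (k : ℕ) (t : K)

theorem neighborMatrix_zero (l : Fin (k + 1)) :
    neighborMatrix k t (Fin.castSucc 0) l.castSucc = 1 := by
  simp only [neighborMatrix, Matrix.of_apply, Fin.snoc_castSucc, Fin.cons_zero]

theorem neighborMatrix_zero_last :
    neighborMatrix k t (Fin.castSucc 0) (Fin.last (k + 1)) = t := by
  simp only [neighborMatrix, Matrix.of_apply, Fin.snoc_castSucc, Fin.cons_zero, Fin.snoc_last]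

theorem neighborMatrix_succ (i : Fin k) (l : Fin (k + 1)) :
    neighborMatrix k t i.succ.castSucc l.castSucc = Pi.single (M := fun _ => K) i.succ 1 l := by
  simp only [neighborMatrix, Matrix.of_apply, Fin.snoc_castSucc, Fin.cons_succ]

theorem neighborMatrix_succ_last (i : Fin k) :
    neighborMatrix k t i.succ.castSucc (Fin.last (k + 1)) = -t := by
  simp only [neighborMatrix, Matrix.of_apply, Fin.snoc_castSucc, Fin.cons_succ, Fin.snoc_last]

theorem neighborMatrix_last (l : Fin (k + 1)) :
    neighborMatrix k t (Fin.last (k + 1)) l.castSucc = 0 := by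
  simp only [neighborMatrix, Matrix.of_apply, Fin.snoc_castSucc, Fin.snoc_last, Pi.zero_apply]

theorem neighborMatrix_last_last :
    neighborMatrix k t (Fin.last (k + 1)) (Fin.last (k + 1)) = 1 := by
  simp only [neighborMatrix, Matrix.of_apply, Fin.snoc_last]

theorem det_neighborMatrix : (neighborMatrix k t).det = 1 := by
  rw [Matrix.det_of_isUpperTriangular]
  · refine Finset.prod_eq_one fun i _ => ?_
    induction i using Fin.lastCases with
    | last => exact neighborMatrix_last_last k t
    | cast i =>
      induction i using Fin.cases with
      | zero => exact neighborMatrix_zero k t 0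
      | succ i => rw [neighborMatrix_succ, Pi.single_eq_same]
  · intro i j hji
    induction i using Fin.lastCases with
    | last =>
      induction j using Fin.lastCases with
      | last => exact absurd hji (lt_irrefl _)
      | cast j => exact neighborMatrix_last k t j
    | cast i =>
      induction i using Fin.cases with
      | zero => exact absurd hji (by simp)
      | succ i =>
        induction j using Fin.lastCases with
        | last => exact absurd hji (not_lt.2 (Fin.le_last _))
        | cast j =>
          rw [neighborMatrix_succ, Pi.single_eq_of_ne]
          rintro rfl
          exact lt_irrefl _ hji

end neighborMatrix

namespace IsImaginaryQuadratic

variable {K : Type u} [Field K] [NumberField K] {D : ℤ} {δ : K} {σ : K ≃ₐ[ℚ] K}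

/-- The even neighbour of the lattice `⟨1⟩ ⊥ ⋯ ⊥ ⟨1⟩ ⊥ 𝔞` at the ramified prime above `2`. -/
theorem exists_even_unimodular_of_mem (h : IsImaginaryQuadratic D δ σ) (hD : ¬ D ≡ 1 [ZMOD 4])
    (𝔞 : (FractionalIdeal (𝓞 K)⁰ K)ˣ) (k : ℕ) {t : K}
    (ht : t ∈ (𝔞 : FractionalIdeal (𝓞 K)⁰ K)) {m : ℤ} (hm : Odd m)
    (hNt : Algebra.norm ℚ t = m * FractionalIdeal.absNorm (𝔞 : FractionalIdeal (𝓞 K)⁰ K))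
    (hmod : 4 ∣ (k : ℤ) + 1 + m) :
    ∃ (V : HermitianSpace K σ) (L : HermitianLattice V),
      L.IsDefinite ∧ L.IsEven ∧ L.IsUnimodular ∧ L.rank = k + 2 ∧
        L.HasSteinitzClass (ClassGroup.mk K 𝔞) := by
  obtain ⟨P, hP2, h2P, hP1, hPσ⟩ := h.exists_prime_above_two hD
  set N := FractionalIdeal.absNorm (𝔞 : FractionalIdeal (𝓞 K)⁰ K) with hN
  have hNpos : 0 < N := absNorm_pos 𝔞
  have hN0 : (N : K) ≠ 0 := by exact_mod_cast hNpos.ne'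
  -- The row w = (1,…,1,t) is divided by P. The other rows are chosen so that their ideal multiples
  -- pair with w into P. The ideals P⁻¹, 1, …, 1, P𝔞 multiply to 𝔞 and the matrix has determinant 1,
  -- so volume and Steinitz class are unchanged.
  let I : Fin (k + 1 + 1) → (FractionalIdeal (𝓞 K)⁰ K)ˣ :=
    Fin.snoc (α := fun _ => (FractionalIdeal (𝓞 K)⁰ K)ˣ)
      (Fin.cons (α := fun _ => (FractionalIdeal (𝓞 K)⁰ K)ˣ) P⁻¹ (fun _ : Fin k => 1)) (P * 𝔞)
  have I0 : I (Fin.castSucc 0) = P⁻¹ := by simp only [I, Fin.snoc_castSucc, Fin.cons_zero]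
  have Is : ∀ i : Fin k, I i.succ.castSucc = 1 := fun i => by
    simp only [I, Fin.snoc_castSucc, Fin.cons_succ]
  have Il : I (Fin.last (k + 1)) = P * 𝔞 := by simp only [I, Fin.snoc_last]
  have hdetT : (neighborMatrix k t).det ≠ 0 := by rw [det_neighborMatrix]; exact one_ne_zero
  let Q := HermitianLattice.ofBasisPseudoBasis
    (h.rowBasis (diagCoeff (k + 1) N) (neighborMatrix k t) hdetT) I
  have hQI : Q.ideal = I := rfl
  have htt : (N : K)⁻¹ * (t * σ t) = m := by
    rw [h.mul_conj, hNt]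
    push_cast
    field_simp
  obtain ⟨q, hq⟩ := hmod
  obtain ⟨r, hr⟩ := hm
  have g00 : Q.gram (Fin.castSucc 0) (Fin.castSucc 0) = ((4 * q : ℤ) : K) := by
    rw [h.gram_diagCoeff]
    simp only [neighborMatrix_zero, neighborMatrix_zero_last, htt, map_one, mul_one,
      Finset.sum_const, Finset.card_univ, Fintype.card_fin, nsmul_eq_mul]
    rw [← hq]
    push_cast
    ring
  have g0s : ∀ i : Fin k, Q.gram (Fin.castSucc 0) i.succ.castSucc = ((2 * (-r) : ℤ) : K) := by
    intro i
    rw [h.gram_diagCoeff, Finset.sum_eq_single i.succ]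
    · rw [neighborMatrix_zero, neighborMatrix_succ, neighborMatrix_zero_last,
        neighborMatrix_succ_last, Pi.single_eq_same, map_one, map_neg, mul_neg, mul_neg, htt, hr]
      push_cast
      ring
    · intro l _ hl
      rw [neighborMatrix_succ, Pi.single_eq_of_ne hl, map_zero, mul_zero]
    · simp
  have g0l : Q.gram (Fin.castSucc 0) (Fin.last (k + 1)) = (N : K)⁻¹ * t := by
    rw [h.gram_diagCoeff]
    simp only [neighborMatrix_last, neighborMatrix_zero_last, neighborMatrix_last_last, map_zero,
      map_one, mul_zero, mul_one, Finset.sum_const_zero, zero_add]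
  have gss : ∀ i j : Fin k, Q.gram i.succ.castSucc j.succ.castSucc =
      (((if i = j then 1 else 0) + m : ℤ) : K) := by
    intro i j
    rw [h.gram_diagCoeff, Finset.sum_eq_single i.succ]
    · rw [neighborMatrix_succ, neighborMatrix_succ, neighborMatrix_succ_last,
        neighborMatrix_succ_last, Pi.single_eq_same, map_neg, neg_mul_neg, htt]
      push_cast
      rw [Pi.single_apply]
      simp [Fin.succ_inj]
    · intro l _ hl
      rw [neighborMatrix_succ, Pi.single_eq_of_ne hl, zero_mul]
    · simp
  have gsl : ∀ i : Fin k, Q.gram i.succ.castSucc (Fin.last (k + 1)) = -((N : K)⁻¹ * t) := by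
    intro i
    rw [h.gram_diagCoeff]
    simp only [neighborMatrix_last, neighborMatrix_succ_last, neighborMatrix_last_last, map_zero,
      map_one, mul_zero, mul_one, Finset.sum_const_zero, zero_add, mul_neg]
  have gll : Q.gram (Fin.last (k + 1)) (Fin.last (k + 1)) = (N : K)⁻¹ := by
    rw [h.gram_diagCoeff]
    simp only [neighborMatrix_last, neighborMatrix_last_last, map_zero,
      map_one, mul_zero, mul_one, Finset.sum_const_zero, zero_add]
  -- N(P⁻¹) = 1/2 puts aσ(b) in ½𝓞, so h(w,w) must be divisible by 4, not just by 2, for the values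
  -- to be even.
  have c00 : ∀ a ∈ ((P⁻¹ : (FractionalIdeal (𝓞 K)⁰ K)ˣ) : FractionalIdeal (𝓞 K)⁰ K),
      ∀ b ∈ ((P⁻¹ : (FractionalIdeal (𝓞 K)⁰ K)ˣ) : FractionalIdeal (𝓞 K)⁰ K),
      ∃ c ∈ (1 : Submodule (𝓞 K) K), a * σ b * ((4 * q : ℤ) : K) = 2 * c := by
    intro a ha b hb
    have := h.inv_absNorm_mul_mem_one P⁻¹ ha hb
    rw [Units.val_inv_eq_inv_val, map_inv₀, hP2] at this
    refine ⟨_, mul_mem_one this (intCast_mem_one q), ?_⟩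
    push_cast
    ring
  have c0s : ∀ a ∈ ((P⁻¹ : (FractionalIdeal (𝓞 K)⁰ K)ˣ) : FractionalIdeal (𝓞 K)⁰ K),
      ∀ b ∈ ((1 : (FractionalIdeal (𝓞 K)⁰ K)ˣ) : FractionalIdeal (𝓞 K)⁰ K),
      a * σ b * ((2 * (-r) : ℤ) : K) ∈ (1 : Submodule (𝓞 K) K) := by
    intro a ha b hb
    have h1 : a * 2 ∈ (1 : Submodule (𝓞 K) K) := by
      have := FractionalIdeal.mul_mem_mul ha h2P
      rw [← Units.val_mul, inv_mul_cancel] at this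
      exact mem_one_unit.1 this
    have := mul_mem_one (mul_mem_one h1 (conj_mem_one (σ := σ) (mem_one_unit.1 hb)))
      (intCast_mem_one (-r))
    convert this using 1
    push_cast
    ring
  have c0l : ∀ a ∈ ((P⁻¹ : (FractionalIdeal (𝓞 K)⁰ K)ˣ) : FractionalIdeal (𝓞 K)⁰ K),
      ∀ b ∈ ((P * 𝔞 : (FractionalIdeal (𝓞 K)⁰ K)ˣ) : FractionalIdeal (𝓞 K)⁰ K),
      a * σ b * ((N : K)⁻¹ * t) ∈ (1 : Submodule (𝓞 K) K) := by
    intro a ha b hb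
    rw [Units.val_mul] at hb
    refine FractionalIdeal.mul_induction_on hb (fun p hp α hα => ?_) (fun x y hx hy => ?_)
    · have h1 : a * σ p ∈ (1 : Submodule (𝓞 K) K) := by
        have := FractionalIdeal.mul_mem_mul ha (hPσ p hp)
        rw [← Units.val_mul, inv_mul_cancel] at this
        exact mem_one_unit.1 this
      have := mul_mem_one h1 (h.inv_absNorm_mul_mem_one 𝔞 ht hα)
      convert this using 1
      rw [map_mul]
      ring
    · rw [map_add, mul_add, add_mul]
      exact add_mem hx hy
  have hPa : ∀ b ∈ ((P * 𝔞 : (FractionalIdeal (𝓞 K)⁰ K)ˣ) : FractionalIdeal (𝓞 K)⁰ K),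
      b ∈ (𝔞 : FractionalIdeal (𝓞 K)⁰ K) := by
    intro b hb
    have hle : ((P * 𝔞 : (FractionalIdeal (𝓞 K)⁰ K)ˣ) : FractionalIdeal (𝓞 K)⁰ K) ≤ 𝔞 := by
      rw [Units.val_mul]
      exact (mul_le_mul' hP1 le_rfl).trans_eq (one_mul _)
    exact hle hb
  have csl : ∀ a ∈ ((1 : (FractionalIdeal (𝓞 K)⁰ K)ˣ) : FractionalIdeal (𝓞 K)⁰ K),
      ∀ b ∈ ((P * 𝔞 : (FractionalIdeal (𝓞 K)⁰ K)ˣ) : FractionalIdeal (𝓞 K)⁰ K),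
      a * σ b * -((N : K)⁻¹ * t) ∈ (1 : Submodule (𝓞 K) K) := by
    intro a ha b hb
    have := neg_mem (mul_mem_one (mem_one_unit.1 ha)
      (h.inv_absNorm_mul_mem_one 𝔞 ht (hPa b hb)))
    convert this using 1
    ring
  -- N(P𝔞) = 2N(𝔞): passing from 𝔞 to P𝔞 supplies the factor 2 that makes the last summand even.
  have cll : ∀ a ∈ ((P * 𝔞 : (FractionalIdeal (𝓞 K)⁰ K)ˣ) : FractionalIdeal (𝓞 K)⁰ K),
      ∀ b ∈ ((P * 𝔞 : (FractionalIdeal (𝓞 K)⁰ K)ˣ) : FractionalIdeal (𝓞 K)⁰ K),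
      ∃ c ∈ (1 : Submodule (𝓞 K) K), a * σ b * (N : K)⁻¹ = 2 * c := by
    intro a ha b hb
    have := h.inv_absNorm_mul_mem_one (P * 𝔞) ha hb
    rw [Units.val_mul, map_mul, hP2, ← hN] at this
    refine ⟨_, this, ?_⟩
    push_cast
    field_simp
  -- Hermitian symmetry leaves only one of the positions (i,j) and (j,i) to check.
  have hsymm : ∀ {i j : Fin (k + 1 + 1)} {a b : K},
      b * σ a * Q.gram j i ∈ (1 : Submodule (𝓞 K) K) →
        a * σ b * Q.gram i j ∈ (1 : Submodule (𝓞 K) K) := by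
    intro i j a b hab
    have := conj_mem_one (σ := σ) hab
    rw [map_mul, map_mul, h.conj_conj, Q.gram_conj] at this
    rwa [mul_comm a]
  have two_mem : ∀ {x : K}, (∃ c ∈ (1 : Submodule (𝓞 K) K), x = 2 * c) →
      x ∈ (1 : Submodule (𝓞 K) K) := by
    rintro _ ⟨c, hc, rfl⟩
    exact mul_mem_one (by simpa using intCast_mem_one (K := K) 2) hc
  have hint := Q.form_mem_one (by
    intro i j a ha b hb
    rw [hQI] at ha hb
    induction i using Fin.lastCases with
    | last =>
      rw [Il] at ha
      induction j using Fin.lastCases with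
      | last =>
        rw [Il] at hb
        rw [gll]
        exact two_mem (cll a ha b hb)
      | cast j =>
        apply hsymm
        induction j using Fin.cases with
        | zero =>
          rw [I0] at hb
          rw [g0l]
          exact c0l b hb a ha
        | succ j =>
          rw [Is] at hb
          rw [gsl]
          exact csl b hb a ha
    | cast i =>
      induction i using Fin.cases with
      | zero =>
        rw [I0] at ha
        induction j using Fin.lastCases with
        | last =>
          rw [Il] at hb
          rw [g0l]
          exact c0l a ha b hb
        | cast j =>
          induction j using Fin.cases with
          | zero =>
            rw [I0] at hb
            rw [g00]
            exact two_mem (c00 a ha b hb)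
          | succ j =>
            rw [Is] at hb
            rw [g0s]
            exact c0s a ha b hb
      | succ i =>
        rw [Is] at ha
        induction j using Fin.lastCases with
        | last =>
          rw [Il] at hb
          rw [gsl]
          exact csl a ha b hb
        | cast j =>
          induction j using Fin.cases with
          | zero =>
            apply hsymm
            rw [I0] at hb
            rw [g0s]
            exact c0s b hb a ha
          | succ j =>
            rw [Is] at hb
            rw [gss]
            exact mul_mem_one (mul_mem_one (mem_one_unit.1 ha) (conj_mem_one (mem_one_unit.1 hb)))
              (intCast_mem_one _))
  have hdiag : ∀ i, ∀ a ∈ (Q.ideal i : FractionalIdeal (𝓞 K)⁰ K),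
      a * σ a * Q.gram i i ∈ Submodule.span (𝓞 K) {(2 : K)} := by
    intro i a ha
    rw [hQI] at ha
    induction i using Fin.lastCases with
    | last =>
      rw [Il] at ha
      obtain ⟨c, hc, e⟩ := cll a ha a ha
      rw [gll, e]
      exact two_mul_mem_span_two hc
    | cast i =>
      induction i using Fin.cases with
      | zero =>
        rw [I0] at ha
        obtain ⟨c, hc, e⟩ := c00 a ha a ha
        rw [g00, e]
        exact two_mul_mem_span_two hc
      | succ i =>
        rw [Is] at ha
        have e : a * σ a * Q.gram i.succ.castSucc i.succ.castSucc =
            2 * (a * σ a * ((1 + r : ℤ) : K)) := by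
          rw [gss, if_pos rfl, hr]
          push_cast
          ring
        rw [e]
        exact two_mul_mem_span_two (mul_mem_one (mul_mem_one (mem_one_unit.1 ha)
          (conj_mem_one (mem_one_unit.1 ha))) (intCast_mem_one _))
  refine ⟨_, _, h.isDefinite_diagSpace (diagCoeff_pos (k + 1) hNpos) _,
    Q.isEven h hD hint hdiag, Q.isUnimodular h (by omega) hint ?_, (Q.eq_rank Q.isOn).symm,
    k + 1 + 1, Q, ?_⟩
  · rw [h.det_gram_rowBasis, prod_diagCoeff, det_neighborMatrix, hQI, Fin.prod_univ_castSucc,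
      Fin.prod_univ_succ, I0, Il, Finset.prod_congr rfl fun i _ => by rw [Is]]
    simp only [Units.val_inv_eq_inv_val, map_inv₀, hP2, Units.val_one, map_one, Units.val_mul,
      map_mul, Finset.prod_const_one, mul_one, one_mul, ← hN]
    push_cast
    field_simp
  · rw [hQI, Fin.prod_univ_castSucc, Fin.prod_univ_succ, I0, Il,
      Finset.prod_congr rfl fun i _ => Is i, Finset.prod_const_one, mul_one,
      inv_mul_cancel_left]

/-- The existence of definite even unimodular lattices. -/
theorem exists_even_unimodular (h : IsImaginaryQuadratic D δ σ) (hD : ¬ D ≡ 1 [ZMOD 4])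
    (𝔞 : (FractionalIdeal (𝓞 K)⁰ K)ˣ) {n : ℕ} (hn : 1 ≤ n) (hev : Even n)
    (hsymb : D ≡ 3 [ZMOD 4] → normResidueSymbol K 2
      ((FractionalIdeal.absNorm (𝔞 : FractionalIdeal (𝓞 K)⁰ K) : ℚ) : ℚ_[2]) = (-1) ^ (n / 2)) :
    ∃ (V : HermitianSpace K σ) (L : HermitianLattice V),
      L.IsDefinite ∧ L.IsEven ∧ L.IsUnimodular ∧ L.rank = n ∧
        L.HasSteinitzClass (ClassGroup.mk K 𝔞) := by
  obtain ⟨k, rfl⟩ : ∃ k, n = k + 2 := by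
    obtain ⟨l, rfl⟩ := hev
    exact ⟨2 * l - 2, by omega⟩
  obtain ⟨t, ht, m, hm, hNt⟩ := h.exists_odd_norm 𝔞
  have hm0 : (m : ℚ) ≠ 0 := by
    have : m ≠ 0 := by rintro rfl; simp at hm
    exact_mod_cast this
  have hk : Even k := by simpa [Nat.even_add] using hev
  by_cases hD3 : D ≡ 3 [ZMOD 4]
  · refine h.exists_even_unimodular_of_mem hD 𝔞 k ht hm hNt ?_
    have hNpos := absNorm_pos 𝔞
    have ht0 : t ≠ 0 := by
      rintro rfl
      rw [Algebra.norm_zero] at hNt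
      exact mul_ne_zero hm0 hNpos.ne' hNt.symm
    have hm0' : (m : K) ≠ 0 := by exact_mod_cast hm0
    have hNM : Algebra.norm ℚ (m : K) = m ^ 2 := by
      have := h.norm_eq m 0
      simpa using this
    -- Up to a global norm N(𝔞) is m, so the symbol condition says m ≡ (-1)^((k+2)/2) (mod 4). For
    -- even k this is exactly 4 ∣ k + 1 + m.
    have e : FractionalIdeal.absNorm (𝔞 : FractionalIdeal (𝓞 K)⁰ K) =
        m * Algebra.norm ℚ (t / m) := by
      rw [div_eq_mul_inv, map_mul, Algebra.norm_inv, hNM, hNt]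
      field_simp
    have hs := hsymb hD3
    rw [e, h.normResidueSymbol_two hD3 hm (div_ne_zero ht0 hm0')] at hs
    rw [Int.odd_iff] at hm
    have h2 : (k + 2) / 2 = k / 2 + 1 := by omega
    rw [h2] at hs
    obtain ⟨l, rfl⟩ := hk
    have h3 : (l + l) / 2 = l := by omega
    rw [h3, pow_succ] at hs
    simp only [Int.ModEq] at hs
    rcases Nat.even_or_odd' l with ⟨j, rfl | rfl⟩
    · rw [pow_mul] at hs
      norm_num at hs
      push_cast
      omega
    · rw [pow_succ, pow_mul] at hs
      norm_num at hs
      push_cast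
      omega
  · have hD2 : D % 4 = 2 := by
      have h4 : ¬ D % 4 = 0 := by
        intro h0
        have : (2 : ℤ) * 2 ∣ D := by simpa using Int.dvd_of_emod_eq_zero h0
        have := h.squarefree 2 this
        rw [Int.isUnit_iff] at this
        omega
      simp only [Int.ModEq] at hD hD3
      omega
    by_cases hmod : 4 ∣ (k : ℤ) + 1 + m
    · exact h.exists_even_unimodular_of_mem hD 𝔞 k ht hm hNt hmod
    -- Here k + 1 + m ≡ 2 (mod 4). Multiplying t by 1 + δ, of norm 1 - D ≡ -1 (mod 4), replaces m by
    -- -m modulo 4. As m is odd, this shifts the sum by 2.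
    · obtain ⟨d, hd⟩ : ∃ d : 𝓞 K, (d : K) = 1 + δ :=
        ⟨⟨1 + δ, isIntegral_one.add h.isIntegral_sqrt⟩, rfl⟩
      have hNd : Algebra.norm ℚ (1 + δ) = 1 - D := by
        have := h.norm_eq 1 1
        simpa using this
      obtain ⟨j, hj⟩ : ∃ j, D = 4 * j + 2 := ⟨D / 4, by omega⟩
      refine h.exists_even_unimodular_of_mem hD 𝔞 k (t := (1 + δ) * t) (m := (1 - D) * m) ?_ ?_ ?_ ?_
      · rw [← hd]
        have := ((𝔞 : FractionalIdeal (𝓞 K)⁰ K) : Submodule (𝓞 K) K).smul_mem d ht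
        rwa [Algebra.smul_def] at this
      · refine Odd.mul ?_ hm
        rw [Int.odd_iff]
        omega
      · rw [map_mul, hNd, hNt]
        push_cast
        ring
      · rw [hj, show (1 - (4 * j + 2)) * m = -m - 4 * (j * m) by ring]
        rw [Int.odd_iff] at hm
        obtain ⟨l, rfl⟩ := hk
        push_cast at hmod ⊢
        omega

end IsImaginaryQuadratic

/-! ### The theorem. -/

/-- `K = ℚ(√D)` with `D < 0` square-free, and `σ` is its nontrivial automorphism. -/
theorem theorem2 {K : Type u} [Field K] [NumberField K] (D : ℤ) (hD : D < 0) (hsq : Squarefree D)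
    (δ : K) (hδ : δ ^ 2 = (D : K)) (hK : IntermediateField.adjoin ℚ {δ} = ⊤)
    (σ : K ≃ₐ[ℚ] K) (hσ : σ ≠ AlgEquiv.refl)
    (𝔞 : (FractionalIdeal (𝓞 K)⁰ K)ˣ) (n : ℕ) (hn : 1 ≤ n) :
    (∃ (V : HermitianSpace K σ) (L : HermitianLattice V),
      L.IsDefinite ∧ L.IsOdd ∧ L.IsUnimodular ∧ L.rank = n ∧
        L.HasSteinitzClass (ClassGroup.mk K 𝔞)) ∧
    ((∃ (V : HermitianSpace K σ) (L : HermitianLattice V),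
      L.IsDefinite ∧ L.IsEven ∧ L.IsUnimodular ∧ L.rank = n ∧
        L.HasSteinitzClass (ClassGroup.mk K 𝔞)) ↔
      Even (NumberField.discr K) ∧ Even n ∧
        (D ≡ 3 [ZMOD 4] →
          normResidueSymbol K 2
            ((FractionalIdeal.absNorm (𝔞 : FractionalIdeal (𝓞 K)⁰ K) : ℚ) : ℚ_[2]) =
              (-1) ^ (n / 2))) := by
  have h := IsImaginaryQuadratic.of_adjoin hD hsq hδ hK hσ
  refine ⟨?_, ?_, ?_⟩
  · obtain ⟨k, rfl⟩ := Nat.exists_eq_add_of_le' hn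
    exact h.exists_odd_unimodular 𝔞 k
  · rintro ⟨V, L, hdef, hev, huni, hrank, hst⟩
    rw [h.even_discr_iff]
    exact HermitianLattice.conditions_of_isEven h hdef hev huni hrank hst
  · rintro ⟨hdisc, hne, hsymb⟩
    exact h.exists_even_unimodular (h.even_discr_iff.1 hdisc) 𝔞 hn hne hsymb
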